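/- Let $\mathfrak g$ be a simple complex Lie algebra of simply-laced type, with Dynkin vertex set $I$, Cartan matrix $C=(c_{ij})$, simple roots $\alpha_i$, simple reflections $s_i$, positive roots $\Phi_+$, $N=\#\Phi_+$, Weyl group $W$ and longest element $w_0$; let $i\mapsto i^*$ be the involution of $I$ with $w_0(\alpha_i)=-\alpha_{i^*}$. Let $Q$ be an orientation of the Dynkin diagram and $\xi:I\to\mathbb Z$ a height function adapted to $Q$, i.e. $\xi(j)=\xi(i)-1$ for every arrow $i\to j$. A word $(i_1,\dots,i_k)$ is adapted to $Q$ if $i_1$ is a source of $Q$, $i_2$ is a source of $s_{i_1}(Q)$, and so on, where $s_i(Q)$ is $Q$ with all arrows at $i$ reversed. Let $\tau_Q\in W$ be the Coxeter element given by a word adapted to $Q$ that contains every vertex exactly once, and let $(i_1,\dots,i_N)$ be a reduced expression of $w_0$ adapted to $Q$, extended to an infinite sequence by $i_{k+Nm}=i_k$ ($m$ even) and $i_{k+Nm}=i_k^*$ ($m$ odd) for $1\le k\le N$, $m\geq 0$. Let $\langle\cdot,\cdot\rangle_Q$ be the bilinear form on $\bigoplus_i\mathbb Z\alpha_i$ with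 $\langle\alpha_i,\alpha_j\rangle_Q=\delta_{ij}-\#\{i\to j \text{ in } Q\}$. Put $I^{\le\xi}=\{(i,p): i\in I,\ p\in\xi(i)+2\mathbb Z_{\le0}\}$, and let $\varphi:I^{\le\xi}\to\mathbb Z_{\ge1}$ be the bijection for which $\varphi(i,p)$ is the position of the $m$-th occurrence of $i$ in $(i_1,i_2,\dots)$, $m=(\xi(i)-p+2)/2$; equivalently $\varphi^{-1}(t)=(i_t,\xi(i_t)-2\,\#\{t'\le t: i_{t'}=i_t\}+2)$. Let $\gamma_j$ be the sum of the $\alpha_i$ such that there is a (possibly trivial) path from $i$ to $j$ in $Q$, and define positive roots $\beta_t$, $t\ge1$, by $\beta_{\varphi(j,\xi(j))}=\gamma_j$ and $\beta_{\varphi(j,s-2)}=\pm\tau_Q(\beta_{\varphi(j,s)})$, with the sign that makes it positive. Let $\tilde C_{ij}(m)$, for $m\ge1$, be the coefficient of $z^m$ in the expansion at $z=0$ of the $(i,j)$ entry of the inverse of the quantum Cartan matrix $C(z)$ ($C_{ii}(z)=z+z^{-1}$, and $C_{ij}(z)=c_{ij}$ for $i\ne j$), and $\tilde C_{ij}(m)=0$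 for $m\le0$. Let $$\widetilde D_\xi:\mathbb C[Y_{i,p}^{\pm1},(i,p)\in I^{\le\xi}]\to\mathbb C(\alpha_i,\,i\in I),\qquad \widetilde D_\xi(Y_{i,p})=\prod_{(j,s)\in I^{\le\xi}}\beta_{\varphi(j,s)}^{\tilde C_{ij}(s-p-1)-\tilde C_{ij}(s-p+1)}$$ (an algebra morphism; the product is finite). Let $\mathcal A^{\le\xi}$ be the Hernandez–Leclerc cluster algebra, with initial cluster $(x_t)_{t\ge1}$ and exchange quiver with vertex set $I^{\le\xi}$ (where $(i,p)$ carries $x_{\varphi(i,p)}$) and an arrow $(i,r)\to(j,s)$ if and only if $c_{ij}\ne0$ and $s=r+c_{ij}$. Let $\iota:\mathcal A^{\le\xi}\to\mathbb C[Y_{i,p}^{\pm1}]$ be the algebra embedding with $\iota(x_{\varphi(i,p)})=Y_{i,p}Y_{i,p+2}\cdots Y_{i,\xi(i)}$ (the truncated $q$-character of the Kirillov–Reshetikhin module $X_{i,p}$). Then for every $t\ge1$ (in particular for $1\le t\le 2N$) there are $n_t(\beta)\in\mathbb N$, $\beta\in\Phi_+$, such that $$\widetilde D_\xi(\iota(x_t))=\prod_{\beta\in\Phi_+}\frac1{\beta^{n_t(\beta)}},$$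 and $n_t(\beta)=|\langle\beta_t,\beta\rangle_Q|$ whenever $n_t(\beta)\ne0$. -/

import Mathlib

open scoped BigOperators

noncomputable section

namespace HL

/-! ## Simply-laced Dynkin data, roots, Weyl group -/

/-- The Cartan matrix of a simple complex Lie algebra of simply-laced type with Dynkin vertex
set `I`: an indecomposable, positive definite, symmetric integer matrix with diagonal entries `2`
and off-diagonal entries in `{0, -1}`. -/
structure SimplyLacedCartan (I : Type*) [Fintype I] where
  C : Matrix I I ℤ
  symm : C.IsSymm
  diag : ∀ i, C i i = 2
  simplyLaced : C.IsSimplyLaced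
  posDef : (C.map (Int.cast : ℤ → ℝ)).PosDef
  connected : (SimpleGraph.fromRel fun i j => C i j = -1).Connected

section Roots

variable {I : Type*} [Fintype I] [DecidableEq I] (D : SimplyLacedCartan I)

/-- The simple root `α_i`, in the root lattice `Γ = ⊕ ℤ α_i`, which is written `I → ℤ`. -/
def simpleRoot (i : I) : I → ℤ := Pi.single i 1

/-- The linear form `x ↦ (α_i, x)` given by the Cartan pairing. -/
def coroot (i : I) : Module.Dual ℤ (I → ℤ) := (LinearMap.proj i).comp (Matrix.mulVecLin D.C)

theorem coroot_simpleRoot (i : I) : coroot D i (simpleRoot i) = 2 := by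
  simp [coroot, simpleRoot, D.diag]

/-- The simple reflection `s_i`, `x ↦ x - (α_i, x) α_i`. -/
def simpleReflection (i : I) : (I → ℤ) ≃ₗ[ℤ] (I → ℤ) :=
  Module.reflection (coroot_simpleRoot D i)

/-- The Weyl group. -/
def weylGroup : Subgroup ((I → ℤ) ≃ₗ[ℤ] (I → ℤ)) :=
  Subgroup.closure (Set.range (simpleReflection D))

/-- The root system `Φ`, the Weyl group orbit of the simple roots. -/
def roots : Set (I → ℤ) := {x | ∃ w ∈ weylGroup D, ∃ i, x = w (simpleRoot i)}

/-- The positive roots `Φ₊ = Φ ∩ ⊕ ℕ α_i`. -/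
def posRoots : Set (I → ℤ) := {x | x ∈ roots D ∧ ∀ i, 0 ≤ x i}

theorem form_reflection (i : I) (x : I → ℤ) :
    simpleReflection D i x ⬝ᵥ (D.C.mulVec (simpleReflection D i x)) = x ⬝ᵥ (D.C.mulVec x) := by
  have h : simpleReflection D i x = x - (D.C.mulVec x i) • (simpleRoot i : I → ℤ) := by
    simp [simpleReflection, Module.reflection_apply, coroot]
  have h1 : (simpleRoot i : I → ℤ) ⬝ᵥ (D.C.mulVec x) = D.C.mulVec x i := by
    simp [simpleRoot]
  have h2 : x ⬝ᵥ (D.C.mulVec (simpleRoot i : I → ℤ)) = D.C.mulVec x i := by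
    rw [Matrix.dotProduct_mulVec, ← Matrix.mulVec_transpose, D.symm.eq]
    simp [simpleRoot]
  have h3 : (simpleRoot i : I → ℤ) ⬝ᵥ (D.C.mulVec (simpleRoot i : I → ℤ)) = 2 := by
    simp [simpleRoot, D.diag]
  rw [h]
  simp only [Matrix.mulVec_sub, Matrix.mulVec_smul, sub_dotProduct, dotProduct_sub,
    smul_dotProduct, dotProduct_smul, h1, h2, h3, smul_eq_mul]
  ring

theorem form_weyl {w : (I → ℤ) ≃ₗ[ℤ] (I → ℤ)} (hw : w ∈ weylGroup D) :
    ∀ x : I → ℤ, w x ⬝ᵥ (D.C.mulVec (w x)) = x ⬝ᵥ (D.C.mulVec x) := by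
  induction hw using Subgroup.closure_induction with
  | mem w hw => obtain ⟨i, rfl⟩ := hw; exact form_reflection D i
  | one => intro x; rfl
  | mul a b _ _ ha hb => intro x; rw [LinearEquiv.mul_apply, ha, hb]
  | inv a _ ha =>
    intro x
    rw [← ha (a⁻¹ x), ← LinearEquiv.mul_apply, mul_inv_cancel]; rfl

theorem form_root {x : I → ℤ} (hx : x ∈ roots D) : x ⬝ᵥ (D.C.mulVec x) = 2 := by
  obtain ⟨w, hw, i, rfl⟩ := hx
  rw [form_weyl D hw]
  simp [simpleRoot, D.diag]

theorem form_bound : ∃ m : ℝ, 0 < m ∧ ∀ x : I → ℝ,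
    m * ‖x‖ ^ 2 ≤ x ⬝ᵥ ((D.C.map (Int.cast : ℤ → ℝ)).mulVec x) := by
  set A := D.C.map (Int.cast : ℤ → ℝ)
  have hcont : Continuous fun x : I → ℝ => x ⬝ᵥ (A.mulVec x) := by fun_prop
  have hpos : ∀ x : I → ℝ, x ≠ 0 → 0 < x ⬝ᵥ (A.mulVec x) := by
    intro x hx
    simpa using D.posDef.dotProduct_mulVec_pos hx
  by_cases hne : (Metric.sphere (0 : I → ℝ) 1).Nonempty
  · obtain ⟨y, hy, hmin⟩ := (isCompact_sphere (0 : I → ℝ) 1).exists_isMinOn hne hcont.continuousOn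
    have hy0 : y ≠ 0 := by
      rintro rfl
      simp at hy
    refine ⟨_, hpos y hy0, fun x => ?_⟩
    by_cases hx : x = 0
    · simp [hx]
    have hn : ‖x‖ ≠ 0 := norm_ne_zero_iff.mpr hx
    have hs : ‖x‖⁻¹ • x ∈ Metric.sphere (0 : I → ℝ) 1 := by
      simp [norm_smul, hn]
    have h := hmin hs
    simp only [Set.mem_ofPred_eq, Matrix.mulVec_smul, smul_dotProduct, dotProduct_smul,
      smul_eq_mul] at h
    calc y ⬝ᵥ (A.mulVec y) * ‖x‖ ^ 2
        ≤ (‖x‖⁻¹ * (‖x‖⁻¹ * x ⬝ᵥ (A.mulVec x))) * ‖x‖ ^ 2 := by gcongr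
      _ = x ⬝ᵥ (A.mulVec x) := by field_simp
  · refine ⟨1, one_pos, fun x => ?_⟩
    by_cases hx : x = 0
    · simp [hx]
    · exact absurd ⟨‖x‖⁻¹ • x, by simp [norm_smul, norm_ne_zero_iff.mpr hx]⟩ hne

theorem finite_roots : (roots D).Finite := by
  obtain ⟨m, hm, hb⟩ := form_bound D
  obtain ⟨B, hB⟩ := exists_nat_gt (2 / m + 1)
  refine (Set.finite_Icc (fun _ : I => -(B : ℤ)) (fun _ => (B : ℤ))).subset fun x hx => ?_
  have h2 := hb (fun i => (x i : ℝ))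
  have h3 : (fun i => (x i : ℝ)) ⬝ᵥ
      ((D.C.map (Int.cast : ℤ → ℝ)).mulVec fun i => (x i : ℝ)) = 2 := by
    have h := form_root D hx
    have h' : ((x ⬝ᵥ (D.C.mulVec x) : ℤ) : ℝ) = 2 := by rw [h]; norm_num
    rw [← h']
    simp [dotProduct, Matrix.mulVec, Matrix.map_apply]
  rw [h3] at h2
  set r := ‖fun i => (x i : ℝ)‖ with hr
  have h4 : r ^ 2 ≤ 2 / m := by rw [le_div_iff₀ hm]; linarith
  have h5 : r < B := by nlinarith [norm_nonneg (fun i => (x i : ℝ)), sq_nonneg (r - 1)]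
  have h6 : ∀ i, |x i| ≤ (B : ℤ) := by
    intro i
    have h7 : |(x i : ℝ)| ≤ r := by
      simpa using norm_le_pi_norm (fun i => (x i : ℝ)) i
    have h8 : |(x i : ℝ)| ≤ (B : ℝ) := by linarith
    exact_mod_cast h8
  exact ⟨fun i => (abs_le.mp (h6 i)).1, fun i => (abs_le.mp (h6 i)).2⟩

instance : Finite (posRoots D) := ((finite_roots D).subset fun _ hx => hx.1).to_subtype

instance : Fintype (posRoots D) := Fintype.ofFinite _

/-- The product `s_{i_1} ⋯ s_{i_k}` of simple reflections along a word. -/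
def wordProd (l : List I) : (I → ℤ) ≃ₗ[ℤ] (I → ℤ) := (l.map (simpleReflection D)).prod

/-- A word of minimal length among the words with the same product. -/
def IsReducedWord (l : List I) : Prop :=
  ∀ l' : List I, wordProd D l' = wordProd D l → l.length ≤ l'.length

/-- `w` is the longest element `w_0` of the Weyl group: the element of `W` with
`w Φ₊ = - Φ₊`. -/
def IsLongestElement (w : (I → ℤ) ≃ₗ[ℤ] (I → ℤ)) : Prop :=
  w ∈ weylGroup D ∧ ∀ x, x ∈ posRoots D ↔ -(w x) ∈ posRoots D

end Roots

/-! ## Quivers, adapted words, the Euler-Ringel form -/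

section Quiver

variable {I : Type*}

/-- `Q i j` means that there is an arrow `i → j`; `Q` orients the Dynkin diagram of `D`. -/
def IsOrientation [Fintype I] (D : SimplyLacedCartan I) (Q : I → I → Prop) : Prop :=
  (∀ i j, Q i j → D.C i j = -1) ∧ ∀ i j, D.C i j = -1 → Xor (Q i j) (Q j i)

/-- A height function adapted to `Q`. -/
def IsHeightFunction (Q : I → I → Prop) (ξ : I → ℤ) : Prop :=
  ∀ i j, Q i j → ξ j = ξ i - 1

def IsSource (Q : I → I → Prop) (i : I) : Prop := ∀ j, ¬ Q j i

/-- `s_i(Q)`: all arrows with source or target `i` are reversed. -/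
def reflectQuiver (Q : I → I → Prop) (i : I) : I → I → Prop :=
  fun a b => ((a = i ∨ b = i) ∧ Q b a) ∨ (¬ (a = i ∨ b = i) ∧ Q a b)

/-- `(i_1, …, i_k)` is adapted to `Q`: `i_1` is a source of `Q`, `i_2` is a source of
`s_{i_1}(Q)`, and so on. -/
def IsAdapted : (I → I → Prop) → List I → Prop
  | _, [] => True
  | Q, i :: l => IsSource Q i ∧ IsAdapted (reflectQuiver Q i) l

/-- A word adapted to `Q` in which every vertex occurs exactly once. The product of its simple
reflections is the Coxeter element `τ_Q`. -/
def IsCoxeterWord (Q : I → I → Prop) (c : List I) : Prop :=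
  c.Nodup ∧ (∀ i, i ∈ c) ∧ IsAdapted Q c

/-- A reduced expression of `w_0` adapted to `Q`. -/
def IsAdaptedLongestWord [Fintype I] [DecidableEq I] (D : SimplyLacedCartan I)
    (Q : I → I → Prop) (w : List I) : Prop :=
  IsReducedWord D w ∧ IsLongestElement D (wordProd D w) ∧ IsAdapted Q w

open Classical in
/-- The Euler-Ringel form, `⟨α_i, α_j⟩_Q = δ_{ij} - #{i → j}`. -/
def eulerForm [Fintype I] (Q : I → I → Prop) (x y : I → ℤ) : ℤ :=
  ∑ i, ∑ j, x i * y j * ((if i = j then 1 else 0) - (if Q i j then 1 else 0))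

open Classical in
/-- `γ_i`, the sum of the `α_j` over the `j` from which there is a path to `i` in `Q`. -/
def gammaRoot (Q : I → I → Prop) (i : I) : I → ℤ :=
  fun j => if Relation.ReflTransGen Q j i then 1 else 0

end Quiver

/-! ## The set `I^{≤ξ}`, the sequence `î_Q`, and the roots `β_t` -/

section Index

variable {I : Type*}

/-- `I^{≤ξ} = {(i, p) | p ∈ ξ(i) + 2 ℤ_{≤ 0}}`. -/
def IndexSet (ξ : I → ℤ) : Type _ := {q : I × ℤ // ∃ k : ℕ, q.2 = ξ q.1 - 2 * (k : ℤ)}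

/-- The element `(i, ξ(i) - 2k)` of `I^{≤ξ}`. -/
def IndexSet.mk (ξ : I → ℤ) (i : I) (k : ℕ) : IndexSet ξ := ⟨(i, ξ i - 2 * (k : ℤ)), k, rfl⟩

/-- The vertex `i` of `(i, p)`. -/
def IndexSet.vertex {ξ : I → ℤ} (q : IndexSet ξ) : I := q.1.1

/-- The second component `p` of `(i, p)`. -/
def IndexSet.pos {ξ : I → ℤ} (q : IndexSet ξ) : ℤ := q.1.2

/-- The natural number `(ξ(i) - p) / 2` of `(i, p)`. -/
def IndexSet.depth {ξ : I → ℤ} (q : IndexSet ξ) : ℕ := ((ξ q.vertex - q.pos) / 2).toNat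

theorem IndexSet.mk_depth {ξ : I → ℤ} (q : IndexSet ξ) :
    IndexSet.mk ξ q.vertex q.depth = q := by
  obtain ⟨⟨i, p⟩, k, hk⟩ := q
  simp only at hk
  subst hk
  simp [IndexSet.mk, IndexSet.depth, IndexSet.vertex, IndexSet.pos]
  rfl

theorem IndexSet.depth_mk (ξ : I → ℤ) (i : I) (k : ℕ) : (IndexSet.mk ξ i k).depth = k := by
  simp [IndexSet.mk, IndexSet.depth, IndexSet.vertex, IndexSet.pos]

variable [Fintype I] [DecidableEq I] (D : SimplyLacedCartan I)

open Classical in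
/-- `i*`, the vertex with `w_0(α_i) = - α_{i*}`, for `w_0` the product along the word `w`. -/
def starVertex (w : List I) (i : I) : I :=
  if h : ∃ j, wordProd D w (simpleRoot i) = -simpleRoot j then h.choose else i

/-- The infinite sequence `î_Q = (i_1, i_2, …)` that extends `w = (i_1, …, i_N)` by
`i_{k+Nm} = i_k` for even `m` and `i_{k+Nm} = i_k^*` for odd `m` (`1 ≤ k ≤ N`); the index `t`
starts at `1`. -/
def iHat [Nonempty I] (w : List I) (t : ℕ) : I :=
  let a := w.getD ((t - 1) % w.length) (Classical.arbitrary I)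
  if Even ((t - 1) / w.length) then a else starVertex D w a

/-- `φ⁻¹(t) = (i_t, ξ(i_t) - 2 N_Q(t) + 2)`, where `N_Q(t) = #{1 ≤ t' ≤ t | i_{t'} = i_t}`, for
`t ≥ 1`. It is written with `N_Q(t) - 1 = #{1 ≤ t' < t | i_{t'} = i_t}`. -/
def phiInv [Nonempty I] (ξ : I → ℤ) (w : List I) (t : ℕ) : IndexSet ξ :=
  IndexSet.mk ξ (iHat D w t)
    ((Finset.Ico 1 t).filter fun t' => iHat D w t' = iHat D w t).card

open Classical in
/-- `β_{φ(j, ξ(j) - 2k)}`: starting from `γ_j`, apply `τ` repeatedly and correct the sign so that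
the result is a positive root. -/
def betaSeq (Q : I → I → Prop) (τ : (I → ℤ) ≃ₗ[ℤ] (I → ℤ)) (j : I) : ℕ → (I → ℤ)
  | 0 => gammaRoot Q j
  | k + 1 =>
    if τ (betaSeq Q τ j k) ∈ posRoots D then τ (betaSeq Q τ j k) else -τ (betaSeq Q τ j k)

/-- `β_{φ(j,s)}` for `(j,s) ∈ I^{≤ξ}`. -/
def beta (Q : I → I → Prop) (τ : (I → ℤ) ≃ₗ[ℤ] (I → ℤ)) {ξ : I → ℤ} (q : IndexSet ξ) : I → ℤ :=
  betaSeq D Q τ q.vertex q.depth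

theorem betaSeq_ne_zero (Q : I → I → Prop) (τ : (I → ℤ) ≃ₗ[ℤ] (I → ℤ)) (j : I) (k : ℕ) :
    betaSeq D Q τ j k ≠ 0 := by
  induction k with
  | zero =>
    intro h
    have := congrFun h j
    simp [betaSeq, gammaRoot, Relation.ReflTransGen.refl] at this
  | succ k ih =>
    have : τ (betaSeq D Q τ j k) ≠ 0 := by simpa using ih
    rw [betaSeq]
    split_ifs
    · exact this
    · simpa using this

end Index

/-! ## The inverse of the quantum Cartan matrix -/

section QuantumCartan

variable {I : Type*} [Fintype I] [DecidableEq I] (D : SimplyLacedCartan I)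

/-- The quantum Cartan matrix `C(z)`, over the ring of Laurent series `ℤ((z))`. -/
def quantumCartan : Matrix I I (LaurentSeries ℤ) := Matrix.of fun i j =>
  if i = j then HahnSeries.single (1 : ℤ) (1 : ℤ) + HahnSeries.single (-1 : ℤ) (1 : ℤ)
  else if D.C i j = -1 then -1 else 0

/-- The quantum Cartan matrix is invertible over `ℤ((z))`. -/
theorem isUnit_det_quantumCartan : IsUnit (quantumCartan D).det := by
  let M : Matrix I I (PowerSeries ℤ) := Matrix.of fun i j =>
    if i = j then 1 + PowerSeries.X ^ 2 else if D.C i j = -1 then -PowerSeries.X else 0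
  have hM : IsUnit M.det := by
    rw [PowerSeries.isUnit_iff_constantCoeff, RingHom.map_det]
    have h : (PowerSeries.constantCoeff).mapMatrix M = (1 : Matrix I I ℤ) := by
      ext i j
      simp only [RingHom.mapMatrix_apply, Matrix.map_apply, M, Matrix.of_apply, Matrix.one_apply]
      split_ifs <;> simp
    rw [h]
    simp
  have h2 : quantumCartan D = (HahnSeries.single (-1 : ℤ) (1 : ℤ) : LaurentSeries ℤ) •
      (HahnSeries.ofPowerSeries ℤ ℤ).mapMatrix M := by
    ext1 i j
    simp only [quantumCartan, Matrix.smul_apply, RingHom.mapMatrix_apply, Matrix.map_apply, M,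
      Matrix.of_apply]
    split_ifs
    · simp [mul_add, HahnSeries.ofPowerSeries_X_pow, add_comm]
    · simp [HahnSeries.ofPowerSeries_X]
    · simp
  rw [h2, Matrix.det_smul, ← RingHom.map_det]
  refine IsUnit.mul (IsUnit.pow _ ?_) (hM.map _)
  exact IsUnit.of_mul_eq_one (HahnSeries.single (1 : ℤ) (1 : ℤ)) (by simp)

/-- `C̃_{ij}(m)`: the coefficient of `z^m` in the `(i,j)` entry of `C(z)⁻¹` for `m ≥ 1`, and `0`
for `m ≤ 0`. -/
def cTilde (i j : I) (m : ℤ) : ℤ :=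
  if 1 ≤ m then ((quantumCartan D)⁻¹ i j).coeff m else 0

end QuantumCartan

/-! ## The torus and the morphism `D̃_ξ` -/

section Morphism

/-- The Laurent polynomial ring `ℂ[v^{±1}, v ∈ V]`. -/
abbrev LaurentRing (V : Type*) : Type _ := AddMonoidAlgebra ℂ (V →₀ ℤ)

/-- The algebra morphism on a Laurent polynomial ring with given (invertible) values on the
variables. -/
def laurentLift {V A : Type*} [CommRing A] [Algebra ℂ A] (u : V → Aˣ) : LaurentRing V →ₐ[ℂ] A :=
  AddMonoidAlgebra.lift ℂ A (V →₀ ℤ)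
    { toFun := fun e => ((e.toAdd.prod fun v (k : ℤ) => u v ^ k : Aˣ) : A)
      map_one' := by simp
      map_mul' := fun a b => by
        rw [← Units.val_mul, toAdd_mul, Finsupp.prod_add_index']
        · simp
        · intro v m n
          exact zpow_add _ m n }

theorem laurentLift_single {V A : Type*} [CommRing A] [Algebra ℂ A] (u : V → Aˣ) (v : V) :
    laurentLift u (AddMonoidAlgebra.single (Finsupp.single v 1) 1) = (u v : A) := by
  rw [laurentLift, AddMonoidAlgebra.lift_single]
  change (1 : ℂ) • (((Finsupp.single v (1 : ℤ)).prod fun v (k : ℤ) => u v ^ k : Aˣ) : A) = _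
  rw [Finsupp.prod_single_index (by simp)]
  simp

/-- The complexified torus `ℂ ⊗ 𝒴^{≤ξ} = ℂ[Y_{i,p}^{±1}, (i,p) ∈ I^{≤ξ}]`. -/
abbrev Torus {I : Type*} (ξ : I → ℤ) : Type _ := LaurentRing (IndexSet ξ)

/-- The variable `Y_{i,p}`. -/
def Y {I : Type*} {ξ : I → ℤ} (q : IndexSet ξ) : Torus ξ :=
  AddMonoidAlgebra.single (Finsupp.single q 1) 1

/-- The field `ℂ(α_i, i ∈ I)`. -/
abbrev RootField (I : Type*) : Type _ := FractionRing (MvPolynomial I ℂ)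

variable {I : Type*} [Fintype I]

/-- An element `∑ x_i α_i` of the root lattice, as an element of `ℂ(α_i, i ∈ I)`. -/
def toField (x : I → ℤ) : RootField I :=
  algebraMap (MvPolynomial I ℂ) (RootField I) (∑ i, MvPolynomial.C (x i : ℂ) * MvPolynomial.X i)

theorem toField_ne_zero {x : I → ℤ} (hx : x ≠ 0) : toField x ≠ 0 := by
  classical
  obtain ⟨i, hi⟩ := Function.ne_iff.mp hx
  intro h
  have h1 : (∑ j, MvPolynomial.C (x j : ℂ) * MvPolynomial.X j : MvPolynomial I ℂ) = 0 :=
    (IsFractionRing.injective (MvPolynomial I ℂ) (RootField I)) (by simpa [toField] using h)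
  have h2 := congrArg (MvPolynomial.eval (Pi.single i (1 : ℂ))) h1
  simp [Pi.single_apply] at h2
  exact hi (by simpa using h2)

variable [DecidableEq I] (D : SimplyLacedCartan I)

/-- `β_{φ(j,s)}` as an invertible element of `ℂ(α_i, i ∈ I)`. -/
def betaUnit (Q : I → I → Prop) (τ : (I → ℤ) ≃ₗ[ℤ] (I → ℤ)) {ξ : I → ℤ} (q : IndexSet ξ) :
    (RootField I)ˣ :=
  Units.mk0 (toField (beta D Q τ q)) (toField_ne_zero (betaSeq_ne_zero D Q τ _ _))

/-- `D̃_ξ(Y_{i,p}) = ∏_{(j,s) ∈ I^{≤ξ}} β_{φ(j,s)} ^ (C̃_{ij}(s-p-1) - C̃_{ij}(s-p+1))`; the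
exponent vanishes for `s < p`, so only finitely many factors differ from `1`. -/
def dTildeY (Q : I → I → Prop) (τ : (I → ℤ) ≃ₗ[ℤ] (I → ℤ)) {ξ : I → ℤ} (q : IndexSet ξ) :
    (RootField I)ˣ :=
  ∏ᶠ r : IndexSet ξ, betaUnit D Q τ r ^
    (cTilde D q.vertex r.vertex (r.pos - q.pos - 1)
      - cTilde D q.vertex r.vertex (r.pos - q.pos + 1))

/-- The algebra morphism `D̃_ξ : ℂ ⊗ 𝒴^{≤ξ} → ℂ(α_i, i ∈ I)` with the above values on the
variables `Y_{i,p}`. -/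
def dTilde (Q : I → I → Prop) (τ : (I → ℤ) ≃ₗ[ℤ] (I → ℤ)) (ξ : I → ℤ) :
    Torus ξ →ₐ[ℂ] RootField I :=
  laurentLift (dTildeY D Q τ)

theorem dTilde_Y (Q : I → I → Prop) (τ : (I → ℤ) ≃ₗ[ℤ] (I → ℤ)) {ξ : I → ℤ} (q : IndexSet ξ) :
    dTilde D Q τ ξ (Y q) = (dTildeY D Q τ q : RootField I) :=
  laurentLift_single _ q

end Morphism

/-! ## The cluster algebra `𝒜^{≤ξ}` and the embedding `ι` -/

section Cluster

/-- A (labelled) seed in the field `F`, without frozen variables: a cluster and an exchange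
matrix, where `b u v` is the number of arrows `u → v` minus the number of arrows `v → u`. -/
structure Seed (V F : Type*) where
  x : V → F
  b : V → V → ℤ

open Classical in
/-- Mutation of a seed in direction `k`. -/
def Seed.mutate {V F : Type*} [Field F] (S : Seed V F) (k : V) : Seed V F where
  x := Function.update S.x k
    ((∏ᶠ v, S.x v ^ (S.b v k).toNat + ∏ᶠ v, S.x v ^ (S.b k v).toNat) / S.x k)
  b := fun u v => if u = k ∨ v = k then -S.b u v
    else S.b u v + max (S.b u k) 0 * max (S.b k v) 0 - max (-S.b u k) 0 * max (-S.b k v) 0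

/-- The cluster algebra of a seed: the algebra generated by the cluster variables of all seeds
obtained by finite sequences of mutations. -/
def clusterAlgebra {V F : Type*} [Field F] [Algebra ℂ F] (S : Seed V F) : Subalgebra ℂ F :=
  Algebra.adjoin ℂ {y | ∃ T : Seed V F,
    Relation.ReflTransGen (fun S₁ S₂ => ∃ k, S₂ = Seed.mutate S₁ k) S T ∧ ∃ v, y = T.x v}

variable {I : Type*} [Fintype I] (D : SimplyLacedCartan I) (ξ : I → ℤ)

/-- Arrows of the exchange quiver on `I^{≤ξ}`: `(i,r) → (j,s)` if and only if `c_{ij} ≠ 0` and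
`s = r + c_{ij}`. -/
def ExchangeArrow (q r : IndexSet ξ) : Prop :=
  D.C q.vertex r.vertex ≠ 0 ∧ r.pos = q.pos + D.C q.vertex r.vertex

/-- The field of rational functions in variables indexed by `I^{≤ξ}`. -/
abbrev ClusterField : Type _ := FractionRing (MvPolynomial (IndexSet ξ) ℂ)

open Classical in
/-- The initial seed of Hernandez and Leclerc; the variable with index `(i,p)` stands for the
class of the Kirillov-Reshetikhin module `X_{i,p}`. -/
def initialSeed : Seed (IndexSet ξ) (ClusterField ξ) where
  x := fun q => algebraMap (MvPolynomial (IndexSet ξ) ℂ) _ (MvPolynomial.X q)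
  b := fun q r => (if ExchangeArrow D ξ q r then 1 else 0) - (if ExchangeArrow D ξ r q then 1 else 0)

/-- The cluster algebra `𝒜^{≤ξ}`. -/
def clusterA : Subalgebra ℂ (ClusterField ξ) := clusterAlgebra (initialSeed D ξ)

/-- The initial cluster variables, as elements of `𝒜^{≤ξ}`. -/
def initialVar (q : IndexSet ξ) : clusterA D ξ :=
  ⟨(initialSeed D ξ).x q, Algebra.subset_adjoin ⟨_, Relation.ReflTransGen.refl, q, rfl⟩⟩

/-- The cluster variable `x_t` of the initial seed, `t ≥ 1`. -/
def clusterVar [DecidableEq I] [Nonempty I] (w : List I) (t : ℕ) : clusterA D ξ :=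
  initialVar D ξ (phiInv D ξ w t)

/-- The monomial `Y_{i,p} Y_{i,p+2} ⋯ Y_{i,ξ(i)}`, which is the truncated `q`-character of the
Kirillov-Reshetikhin module `X_{i,p}`. -/
def monomialKR {I : Type*} {ξ : I → ℤ} (q : IndexSet ξ) : Torus ξ :=
  ∏ l ∈ Finset.range (q.depth + 1), Y (IndexSet.mk ξ q.vertex l)

/-- The substitution `x_{(i,p)} ↦ Y_{i,p} Y_{i,p+2} ⋯ Y_{i,ξ(i)}` on polynomials. -/
def iotaPoly {I : Type*} (ξ : I → ℤ) : MvPolynomial (IndexSet ξ) ℂ →ₐ[ℂ] Torus ξ :=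
  MvPolynomial.aeval monomialKR

/-- The initial cluster variables as units of the field of rational functions. -/
def varUnit {I : Type*} (ξ : I → ℤ) (q : IndexSet ξ) : (ClusterField ξ)ˣ :=
  Units.mk0 (algebraMap (MvPolynomial (IndexSet ξ) ℂ) _ (MvPolynomial.X q)) (by
    rw [Ne, map_eq_zero_iff _ (IsFractionRing.injective _ _)]
    exact MvPolynomial.X_ne_zero q)

/-- `x_{(i,p)} / x_{(i,p+2)}`, where `x_{(i,p+2)}` is replaced by `1` if `p = ξ(i)`. -/
def quotUnit {I : Type*} (ξ : I → ℤ) (i : I) : ℕ → (ClusterField ξ)ˣ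
  | 0 => varUnit ξ (IndexSet.mk ξ i 0)
  | k + 1 => varUnit ξ (IndexSet.mk ξ i (k + 1)) / varUnit ξ (IndexSet.mk ξ i k)

theorem prod_quotUnit {I : Type*} (ξ : I → ℤ) (i : I) (k : ℕ) :
    ∏ l ∈ Finset.range (k + 1), quotUnit ξ i l = varUnit ξ (IndexSet.mk ξ i k) := by
  induction k with
  | zero => simp [quotUnit]
  | succ k ih => rw [Finset.prod_range_succ, ih, quotUnit, mul_div_cancel]

theorem iotaPoly_injective {I : Type*} (ξ : I → ℤ) : Function.Injective (iotaPoly ξ) := by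
  let κ : Torus ξ →ₐ[ℂ] ClusterField ξ := laurentLift fun q => quotUnit ξ q.vertex q.depth
  have h : κ.comp (iotaPoly ξ) = Algebra.algHom ℂ (MvPolynomial (IndexSet ξ) ℂ) _ := by
    apply MvPolynomial.algHom_ext
    intro q
    have h1 : ∀ l, κ (Y (IndexSet.mk ξ q.vertex l)) = (quotUnit ξ q.vertex l : ClusterField ξ) := by
      intro l
      have h2 := laurentLift_single (A := ClusterField ξ)
        (fun q : IndexSet ξ => quotUnit ξ q.vertex q.depth) (IndexSet.mk ξ q.vertex l)
      simp only [IndexSet.depth_mk] at h2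
      exact h2
    simp only [AlgHom.comp_apply, iotaPoly, MvPolynomial.aeval_X, monomialKR, map_prod, h1]
    rw [← Units.coe_prod, prod_quotUnit, IndexSet.mk_depth]
    rfl
  intro a b hab
  have h3 : κ.comp (iotaPoly ξ) a = κ.comp (iotaPoly ξ) b := by
    simp only [AlgHom.comp_apply, hab]
  rw [h] at h3
  exact IsFractionRing.injective (MvPolynomial (IndexSet ξ) ℂ) (ClusterField ξ) h3

/-- The algebra morphism `ι` on `𝒜^{≤ξ}` with `ι(x_{(i,p)}) = Y_{i,p} Y_{i,p+2} ⋯ Y_{i,ξ(i)}`. As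
elements of `𝒜^{≤ξ}` are rational functions in the initial variables, `ι` is written with values in
the fraction field of the torus `ℂ ⊗ 𝒴^{≤ξ}`. -/
def iota : clusterA D ξ →ₐ[ℂ] FractionRing (Torus ξ) :=
  (IsFractionRing.liftAlgHom (K := ClusterField ξ)
    (g := (Algebra.algHom ℂ (Torus ξ) (FractionRing (Torus ξ))).comp (iotaPoly ξ))
    ((IsFractionRing.injective (Torus ξ) (FractionRing (Torus ξ))).comp
      (iotaPoly_injective ξ))).comp (clusterA D ξ).val

theorem iota_initialVar (q : IndexSet ξ) :
    iota D ξ (initialVar D ξ q) = algebraMap (Torus ξ) (FractionRing (Torus ξ)) (monomialKR q) := by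
  simp [iota, initialVar, initialSeed, iotaPoly]
  rfl

end Cluster

end HL

end

/-! Fix (i, p) with p = ξ(i) - 2a, and put v(j, r) = τ^r γ_j, so that the root at (j, ξ(j) - 2r) is
± v(j, r). On Y_{i,p} ⋯ Y_{i,ξ(i)} the exponents of D̃_ξ telescope: the image is the product over s
≥ p of the roots at (j, s) to the power -C̃_{ij}(s-p+1) (`dTilde_monomialKR_eq_prod`).

These coefficients are values of the Euler form. The γ_j are dual to the simple roots, ⟨x, γ_j⟩ =
x_j (`eulerBilin_gammaRoot`), and ⟨y, τx⟩ = -⟨x, y⟩ (`eulerBilin_coxeter`). Hence the v(j, r)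
satisfy mesh relations (`orbitRoot_mesh`), which are the recursion for the coefficients of C(z)⁻¹,
and comparing initial values gives C̃_{ij}(s-p+1) = ⟨v(i, a), v(j, r)⟩ for s = ξ(j) - 2r
(`cTilde_eq_eulerBilin`). So the exponent of 1/β is ⟨v(i, a), β⟩ times the number of (j, r) of
height at least p with v(j, r) = ± β, counted with that sign.

This signed number is 0 or 1 (`sum_occurrenceSign`). Each slice d of the repetition quiver defines
coordinates x ↦ (⟨x, v(j, d j)⟩)_j; moving the slice down past a source j applies s_j to them. A
vector of norm two has coordinates of one sign, and s_j changes that sign only if the coordinates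
are ± α_j, that is, if the vector is ± v(j, d j). So the signed number of occurrences of β above a
slice records whether β is negative for that slice. If β is negative just below height p, its i-th
coordinate ⟨β, v(i, a+1)⟩ = -⟨v(i, a), β⟩ is at most 0; so the exponent ⟨v(i, a), β⟩ is its own
absolute value (`sum_cTilde_eq`). -/

open scoped BigOperators

noncomputable section

namespace HL

/-! ## The Euler form as a bilinear form -/

section Euler

variable {I : Type*}

open Classical in
/-- The number of arrows `i → j`. -/
def arrowCount (Q : I → I → Prop) (i j : I) : ℤ := if Q i j then 1 else 0

theorem arrowCount_nonneg (Q : I → I → Prop) (i j : I) : 0 ≤ arrowCount Q i j := by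
  unfold arrowCount; split_ifs <;> simp

variable [Fintype I]

/-- The Euler-Ringel form as a bilinear map. -/
def eulerBilin (Q : I → I → Prop) : (I → ℤ) →ₗ[ℤ] (I → ℤ) →ₗ[ℤ] ℤ :=
  LinearMap.mk₂ ℤ (eulerForm Q)
    (fun x x' y => by simp [eulerForm, add_mul, Finset.sum_add_distrib])
    (fun a x y => by simp [eulerForm, Finset.mul_sum, mul_assoc])
    (fun x y y' => by simp [eulerForm, mul_add, add_mul, Finset.sum_add_distrib])
    (fun a x y => by
      simp only [eulerForm, Finset.mul_sum, Pi.smul_apply, smul_eq_mul]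
      exact Finset.sum_congr rfl fun _ _ => Finset.sum_congr rfl fun _ _ => by ring)

theorem eulerBilin_apply (Q : I → I → Prop) (x y : I → ℤ) :
    eulerBilin Q x y = eulerForm Q x y := rfl

theorem eulerBilin_eq_sum (Q : I → I → Prop) (x y : I → ℤ) :
    eulerBilin Q x y = ∑ i, x i * (y i - ∑ j, arrowCount Q i j * y j) := by
  classical
  rw [eulerBilin_apply, eulerForm]
  refine Finset.sum_congr rfl fun i _ => ?_
  have h : ∀ j, x i * y j * ((if i = j then 1 else 0) - (if Q i j then 1 else 0))
      = (if i = j then x i * y j else 0) - x i * (arrowCount Q i j * y j) := by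
    intro j
    unfold arrowCount
    split_ifs <;> ring
  simp only [h, Finset.sum_sub_distrib, Finset.sum_ite_eq, Finset.mem_univ, if_true, mul_sub,
    Finset.mul_sum]

theorem form_pos (D : SimplyLacedCartan I) {x : I → ℤ} (hx : x ≠ 0) :
    0 < x ⬝ᵥ D.C.mulVec x := by
  have h0 : (fun i => (x i : ℝ)) ≠ 0 := by
    intro h
    exact hx (funext fun i => by simpa using congrFun h i)
  have h := D.posDef.dotProduct_mulVec_pos h0
  have h' : ((x ⬝ᵥ (D.C.mulVec x) : ℤ) : ℝ) = star (fun i => (x i : ℝ)) ⬝ᵥ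
      ((D.C.map (Int.cast : ℤ → ℝ)).mulVec fun i => (x i : ℝ)) := by
    simp [dotProduct, Matrix.mulVec, Matrix.map_apply]
  rw [← h'] at h
  exact_mod_cast h

theorem form_neg (D : SimplyLacedCartan I) (x : I → ℤ) : (-x) ⬝ᵥ D.C.mulVec (-x) = x ⬝ᵥ D.C.mulVec x := by
  simp [Matrix.mulVec_neg]

variable [DecidableEq I]

theorem eulerBilin_simpleRoot_left (Q : I → I → Prop) (i : I) (y : I → ℤ) :
    eulerBilin Q (simpleRoot i) y = y i - ∑ j, arrowCount Q i j * y j := by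
  rw [eulerBilin_eq_sum, Finset.sum_eq_single i]
  · simp [simpleRoot]
  · intro j _ hj
    simp [simpleRoot, hj]
  · simp

theorem eulerBilin_simpleRoot_right (Q : I → I → Prop) (x : I → ℤ) (j : I) :
    eulerBilin Q x (simpleRoot j) = x j - ∑ i, arrowCount Q i j * x i := by
  rw [eulerBilin_eq_sum]
  simp only [simpleRoot, mul_sub, Finset.sum_sub_distrib]
  congr 1
  · simp [Pi.single_apply]
  · simp [Pi.single_apply, mul_comm]

theorem eq_sum_simpleRoot (x : I → ℤ) : x = ∑ i, x i • (simpleRoot i : I → ℤ) := by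
  ext j
  simp [simpleRoot, Pi.single_apply]

variable {D : SimplyLacedCartan I} {Q : I → I → Prop}

theorem cartan_eq (hQ : IsOrientation D Q) (i j : I) :
    D.C i j = (if i = j then 2 else 0) - arrowCount Q i j - arrowCount Q j i := by
  have hs : D.C j i = D.C i j := D.symm.apply i j
  unfold arrowCount
  by_cases hij : i = j
  · subst hij
    have : ¬ Q i i := fun h => by have := hQ.1 _ _ h; rw [D.diag] at this; omega
    simp [this, D.diag]
  · rcases D.simplyLaced hij with h | h
    · have h1 : ¬ Q i j := fun h' => by have := hQ.1 _ _ h'; omega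
      have h2 : ¬ Q j i := fun h' => by have := hQ.1 _ _ h'; omega
      simp [h, h1, h2, hij]
    · rcases hQ.2 i j h with ⟨h1, h2⟩ | ⟨h1, h2⟩ <;> simp [h, h1, h2, hij]

theorem mulVec_cartan_apply (hQ : IsOrientation D Q) (x : I → ℤ) (i : I) :
    D.C.mulVec x i = 2 * x i - ∑ k, arrowCount Q i k * x k - ∑ k, arrowCount Q k i * x k := by
  simp only [Matrix.mulVec, dotProduct, cartan_eq hQ, sub_mul, Finset.sum_sub_distrib]
  simp

/-- The Cartan form symmetrises the Euler form. Thus ⟨x, x⟩ is half the norm of x, and positivity of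
the Cartan form makes the Euler form nondegenerate. -/
theorem dotProduct_mulVec_cartan (hQ : IsOrientation D Q) (x y : I → ℤ) :
    x ⬝ᵥ D.C.mulVec y = eulerBilin Q x y + eulerBilin Q y x := by
  have h : ∀ i, D.C.mulVec y i
      = eulerBilin Q (simpleRoot i) y + eulerBilin Q y (simpleRoot i) := by
    intro i
    rw [mulVec_cartan_apply hQ, eulerBilin_simpleRoot_left, eulerBilin_simpleRoot_right]
    ring
  conv_rhs => rw [eq_sum_simpleRoot x]
  simp only [dotProduct, h, mul_add, Finset.sum_add_distrib, map_sum, map_smul,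
    LinearMap.sum_apply, LinearMap.smul_apply, smul_eq_mul]

theorem eulerBilin_self_pos (hQ : IsOrientation D Q) {x : I → ℤ} (hx : x ≠ 0) :
    0 < eulerBilin Q x x := by
  have h := form_pos D hx
  rw [dotProduct_mulVec_cartan hQ] at h
  omega

theorem eulerBilin_right_ext (hQ : IsOrientation D Q) {x y : I → ℤ}
    (h : ∀ z, eulerBilin Q z x = eulerBilin Q z y) : x = y := by
  by_contra hne
  have h1 := eulerBilin_self_pos hQ (sub_ne_zero.mpr hne)
  rw [map_sub, h, sub_self] at h1
  exact lt_irrefl _ h1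

theorem simpleReflection_apply (D : SimplyLacedCartan I) (i : I) (x : I → ℤ) :
    simpleReflection D i x = x - (D.C.mulVec x i) • (simpleRoot i : I → ℤ) := by
  simp [simpleReflection, Module.reflection_apply, coroot]

theorem simpleReflection_apply_self (hQ : IsOrientation D Q) (i : I) (x : I → ℤ) :
    simpleReflection D i x i
      = ∑ k, arrowCount Q i k * x k + ∑ k, arrowCount Q k i * x k - x i := by
  rw [simpleReflection_apply]
  simp [simpleRoot, mulVec_cartan_apply hQ]
  ring

theorem simpleReflection_apply_of_ne (D : SimplyLacedCartan I) {i k : I} (h : k ≠ i)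
    (x : I → ℤ) : simpleReflection D i x k = x k := by
  rw [simpleReflection_apply]
  simp [simpleRoot, h]

end Euler

/-! ## Vectors of norm two -/

section Roots

variable {I : Type*} [Fintype I] [DecidableEq I] (D : SimplyLacedCartan I)

theorem form_even (x : I → ℤ) : Even (x ⬝ᵥ D.C.mulVec x) := by
  have key : ∀ s : Finset I, Even (∑ i ∈ s, ∑ j ∈ s, x i * (D.C i j * x j)) := by
    intro s
    induction s using Finset.induction_on with
    | empty => simp
    | insert a s ha ih =>
      have h : ∑ i ∈ insert a s, ∑ j ∈ insert a s, x i * (D.C i j * x j)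
          = 2 * (x a * x a + ∑ j ∈ s, x a * (D.C a j * x j))
            + ∑ i ∈ s, ∑ j ∈ s, x i * (D.C i j * x j) := by
        have h1 : ∑ i ∈ s, x i * (D.C i a * x a) = ∑ j ∈ s, x a * (D.C a j * x j) :=
          Finset.sum_congr rfl fun i _ => by rw [D.symm.apply a i]; ring
        simp only [Finset.sum_insert ha, Finset.sum_add_distrib, h1, D.diag]
        ring
      rw [h]
      exact (even_two_mul _).add ih
  simpa [dotProduct, Matrix.mulVec, Finset.mul_sum] using key Finset.univ

/-- If both parts of x = x⁺ - x⁻ were nonzero, each would have norm at least 2, the form being even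
and positive; the cross term only adds to this, as off-diagonal Cartan entries are at most 0. The
norm of x would be at least 4. -/
theorem nonneg_or_nonpos_of_form_eq_two {x : I → ℤ} (hx : x ⬝ᵥ D.C.mulVec x = 2) :
    0 ≤ x ∨ x ≤ 0 := by
  by_contra! hcon
  have hsplit : x = x⁺ - x⁻ := (posPart_sub_negPart x).symm
  have hp : x⁺ ≠ 0 := fun h => hcon.2 (posPart_eq_zero.mp h)
  have hn : x⁻ ≠ 0 := fun h => hcon.1 (negPart_eq_zero.mp h)
  have hcross : x⁺ ⬝ᵥ D.C.mulVec x⁻ ≤ 0 := by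
    simp only [dotProduct, Matrix.mulVec, Finset.mul_sum]
    refine Finset.sum_nonpos fun i _ => Finset.sum_nonpos fun j _ => ?_
    have h1 : 0 ≤ x⁺ i := posPart_nonneg x i
    have h2 : 0 ≤ x⁻ j := negPart_nonneg x j
    by_cases hij : i = j
    · subst hij
      have : x⁺ i = 0 ∨ x⁻ i = 0 := by
        rcases le_total (x i) 0 with h | h
        · left; simpa [Pi.posPart_apply] using h
        · right; simpa [Pi.negPart_apply] using h
      rcases this with h | h <;> simp [h]
    · rcases D.simplyLaced hij with h | h <;> rw [h] <;> nlinarith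
  have hsymm : x⁻ ⬝ᵥ D.C.mulVec x⁺ = x⁺ ⬝ᵥ D.C.mulVec x⁻ := by
    rw [Matrix.dotProduct_mulVec, ← Matrix.mulVec_transpose, D.symm.eq, dotProduct_comm]
  have h1 := form_pos D hp
  have h2 := form_pos D hn
  obtain ⟨a, ha⟩ := form_even D x⁺
  obtain ⟨b, hb⟩ := form_even D x⁻
  rw [hsplit] at hx
  simp only [Matrix.mulVec_sub, sub_dotProduct, dotProduct_sub, hsymm] at hx
  omega

theorem eq_simpleRoot_of_form_eq_two {x : I → ℤ} (hx : x ⬝ᵥ D.C.mulVec x = 2) (h0 : 0 ≤ x)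
    {i : I} (hi : ∀ k, k ≠ i → x k = 0) : x = simpleRoot i := by
  have h1 : x = x i • (simpleRoot i : I → ℤ) := by
    ext k
    by_cases hk : k = i
    · subst hk; simp [simpleRoot]
    · simp [simpleRoot, hk, hi k hk]
  have h2 : x ⬝ᵥ D.C.mulVec x = x i * x i * 2 := by
    rw [h1]
    simp only [Matrix.mulVec_smul, smul_dotProduct, dotProduct_smul, smul_eq_mul]
    simp [simpleRoot, D.diag]
    ring
  have h3 : x i = 1 := by
    have := h0 i
    simp only [Pi.zero_apply] at this
    nlinarith
  rw [h1, h3, one_smul]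

/-- Only the i-th coordinate changes and the signs stay coherent, so a change of sign forces x to be
supported at i. -/
theorem simpleReflection_nonneg {x : I → ℤ} (hx : x ⬝ᵥ D.C.mulVec x = 2) (h0 : 0 ≤ x) {i : I}
    (hi : x ≠ simpleRoot i) : 0 ≤ simpleReflection D i x := by
  have h2 : simpleReflection D i x ⬝ᵥ D.C.mulVec (simpleReflection D i x) = 2 := by
    rw [form_reflection, hx]
  rcases nonneg_or_nonpos_of_form_eq_two D h2 with h | h
  · exact h
  · refine absurd (eq_simpleRoot_of_form_eq_two D hx h0 fun k hk => ?_) hi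
    have h3 := h k
    rw [simpleReflection_apply_of_ne D hk] at h3
    exact le_antisymm h3 (h0 k)

/-- Descent on the sum of coordinates: as the norm is positive, some i has x_i > 0 and (α_i, x) > 0,
and s_i lowers the sum. Positive roots can then be handled as nonnegative vectors of norm two,
without the Weyl group. -/
theorem mem_roots_of_form_eq_two {x : I → ℤ} (hx : x ⬝ᵥ D.C.mulVec x = 2) (h0 : 0 ≤ x) :
    x ∈ roots D := by
  induction hn : (∑ i, x i).toNat using Nat.strong_induction_on generalizing x with
  | _ n ih =>
    have h1 : ∃ i, 0 < x i * D.C.mulVec x i := by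
      by_contra! h
      have : x ⬝ᵥ D.C.mulVec x ≤ 0 := Finset.sum_nonpos fun i _ => h i
      omega
    obtain ⟨i, hi⟩ := h1
    have hxi : 0 ≤ x i := h0 i
    have hCi : 0 < D.C.mulVec x i := pos_of_mul_pos_right hi hxi
    by_cases hs : x = simpleRoot i
    · exact ⟨1, one_mem _, i, hs⟩
    have h2 := simpleReflection_nonneg D hx h0 hs
    have hsum : ∑ k, simpleReflection D i x k = ∑ k, x k - D.C.mulVec x i := by
      rw [simpleReflection_apply]
      simp [simpleRoot, Pi.single_apply]
    have hpos : 0 ≤ ∑ k, simpleReflection D i x k := Finset.sum_nonneg fun k _ => h2 k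
    obtain ⟨w, hw, j, hj⟩ := ih _ (by omega) (by rw [form_reflection, hx]) h2 rfl
    have hsi : simpleReflection D i ∈ weylGroup D := Subgroup.subset_closure ⟨i, rfl⟩
    refine ⟨(simpleReflection D i)⁻¹ * w, mul_mem (inv_mem hsi) hw, j, ?_⟩
    rw [LinearEquiv.mul_apply, ← hj]
    exact ((simpleReflection D i).symm_apply_apply x).symm

theorem mem_posRoots_iff {x : I → ℤ} :
    x ∈ posRoots D ↔ x ⬝ᵥ D.C.mulVec x = 2 ∧ 0 ≤ x :=
  ⟨fun h => ⟨form_root D h.1, h.2⟩, fun h => ⟨mem_roots_of_form_eq_two D h.1 h.2, h.2⟩⟩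

end Roots

/-! ## The roots `γ_j` and the Coxeter element -/

section Coxeter

variable {I : Type*}

theorem IsHeightFunction.le_of_path {Q : I → I → Prop} {ξ : I → ℤ} (hξ : IsHeightFunction Q ξ)
    {i j : I} (h : Relation.ReflTransGen Q i j) : ξ j ≤ ξ i := by
  induction h with
  | refl => exact le_rfl
  | tail _ h ih => have := hξ _ _ h; omega

theorem gammaRoot_self {Q : I → I → Prop} (j : I) : gammaRoot Q j j = 1 := by
  simp [gammaRoot, Relation.ReflTransGen.refl]

theorem gammaRoot_nonneg {Q : I → I → Prop} (j : I) : 0 ≤ gammaRoot Q j := by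
  intro i
  unfold gammaRoot
  split_ifs <;> simp

/-- Reversing the arrows at a letter does not affect the arrows among the later letters, which are
distinct from it. So all arrows of Q itself between letters point from left to right. -/
theorem IsAdapted.pairwise {l : List I} : ∀ {Q : I → I → Prop}, l.Nodup → IsAdapted Q l →
    l.Pairwise fun a b => ¬ Q b a := by
  induction l with
  | nil => intros; exact List.Pairwise.nil
  | cons i l ih =>
    intro Q hn h
    rw [List.nodup_cons] at hn
    refine List.pairwise_cons.mpr ⟨fun b _ => h.1 b, ?_⟩
    refine (ih hn.2 h.2).imp_of_mem fun {a b} ha hb hab hba => hab ?_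
    right
    refine ⟨?_, hba⟩
    rintro (rfl | rfl)
    · exact hn.1 hb
    · exact hn.1 ha

variable [Fintype I] [DecidableEq I] {D : SimplyLacedCartan I} {Q : I → I → Prop}

/-- Induction from greater to smaller height. The vector p = α_j + ∑_{k → j} γ_k is dual to α_j by
induction, and it remains to see that p is the indicator function of the vertices with a path to j.
-/
theorem eulerBilin_gammaRoot (hQ : IsOrientation D Q) {ξ : I → ℤ} (hξ : IsHeightFunction Q ξ)
    (j : I) (x : I → ℤ) : eulerBilin Q x (gammaRoot Q j) = x j := by
  obtain ⟨M, hM⟩ : ∃ M, ∀ i, ξ i ≤ M := by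
    obtain ⟨M, hM⟩ := (Set.finite_range ξ).bddAbove
    exact ⟨M, fun i => hM ⟨i, rfl⟩⟩
  induction hn : (M - ξ j).toNat using Nat.strong_induction_on generalizing j x with
  | _ n ih =>
    have ih' : ∀ k, ξ j < ξ k → ∀ x, eulerBilin Q x (gammaRoot Q k) = x k := fun k hk x =>
      ih _ (by have := hM j; have := hM k; omega) k x rfl
    set p : I → ℤ := simpleRoot j + ∑ k, arrowCount Q k j • gammaRoot Q k with hp
    have hpx : ∀ x, eulerBilin Q x p = x j := by
      intro x
      have : ∀ k, arrowCount Q k j * eulerBilin Q x (gammaRoot Q k) = arrowCount Q k j * x k := by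
        intro k
        by_cases hk : Q k j
        · rw [ih' k (by have := hξ _ _ hk; omega)]
        · simp [arrowCount, hk]
      simp only [hp, map_add, map_sum, map_smul, smul_eq_mul, this, eulerBilin_simpleRoot_right]
      ring
    have hpi : ∀ i, p i = (if i = j then 1 else 0) + ∑ k, arrowCount Q k j * gammaRoot Q k i := by
      intro i
      simp [hp, simpleRoot, Pi.single_apply]
    have hterm : ∀ i k, 0 ≤ arrowCount Q k j * gammaRoot Q k i := fun i k =>
      mul_nonneg (arrowCount_nonneg _ _ _) (gammaRoot_nonneg k i)
    have hpj : p j = 1 := by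
      rw [hpi, if_pos rfl, Finset.sum_eq_zero, add_zero]
      intro k _
      by_cases hk : Q k j
      · have : ¬ Relation.ReflTransGen Q j k := fun h => by
          have := hξ.le_of_path h; have := hξ _ _ hk; omega
        simp [gammaRoot, this]
      · simp [arrowCount, hk]
    have hpath : ∀ i, i ≠ j → (Relation.ReflTransGen Q i j ↔
        ∃ k, Q k j ∧ Relation.ReflTransGen Q i k) := by
      intro i hi
      constructor
      · intro h
        rcases Relation.ReflTransGen.cases_tail h with h | ⟨k, hk, hkj⟩
        · exact absurd h.symm hi
        · exact ⟨k, hkj, hk⟩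
      · rintro ⟨k, hkj, hk⟩
        exact hk.tail hkj
    have hpg : p = gammaRoot Q j := by
      ext i
      by_cases hi : i = j
      · subst hi; rw [hpj, gammaRoot_self]
      by_cases hij : Relation.ReflTransGen Q i j
      · obtain ⟨k, hkj, hk⟩ := (hpath i hi).mp hij
        have hlt : ξ j < ξ i := by have := hξ.le_of_path hk; have := hξ _ _ hkj; omega
        have hge : 1 ≤ p i := by
          rw [hpi, if_neg hi, zero_add]
          refine le_trans ?_ (Finset.single_le_sum (fun k _ => hterm i k) (Finset.mem_univ k))
          simp [arrowCount, hkj, gammaRoot, hk]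
        have hg0 : gammaRoot Q i j = 0 := by
          have : ¬ Relation.ReflTransGen Q j i := fun h => by have := hξ.le_of_path h; omega
          simp [gammaRoot, this]
        have hne : p - gammaRoot Q i ≠ 0 := fun h => by
          have := congrFun h j
          simp [hpj, hg0] at this
        -- Positivity replaces the uniqueness of paths in a tree: the known pairings give ⟨p - γ_i,
        -- p - γ_i⟩ = 2 - p_i, so p_i ≤ 1.
        have hpos := eulerBilin_self_pos hQ hne
        simp only [map_sub, LinearMap.sub_apply, hpx, ih' i hlt, hpj, hg0, gammaRoot_self] at hpos
        have : gammaRoot Q j i = 1 := by simp [gammaRoot, hij]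
        omega
      · rw [hpi, if_neg hi, zero_add, Finset.sum_eq_zero]
        · simp [gammaRoot, hij]
        · intro k _
          by_cases hk : Q k j
          · have : ¬ Relation.ReflTransGen Q i k := fun h => hij (h.tail hk)
            simp [gammaRoot, this]
          · simp [arrowCount, hk]
    rw [← hpg, hpx]

theorem wordProd_apply_of_notMem (D : SimplyLacedCartan I) {l : List I} {k : I} (hk : k ∉ l)
    (x : I → ℤ) : wordProd D l x k = x k := by
  induction l with
  | nil => rfl
  | cons i l ih =>
    rw [List.mem_cons, not_or] at hk
    change simpleReflection D i (wordProd D l x) k = _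
    rw [simpleReflection_apply_of_ne D hk.1, ih hk.2]

/-- The coordinate at k changes once, when s_k acts. The rightmost letter acts first, so by then the
targets of k carry their new values and the vertices with an arrow to k their old ones. -/
theorem wordProd_apply_add (hQ : IsOrientation D Q) {l : List I} (hn : l.Nodup)
    (hl : l.Pairwise fun a b => ¬ Q b a) (x : I → ℤ) {k : I} (hk : k ∈ l) :
    wordProd D l x k + x k = ∑ m, arrowCount Q k m * wordProd D l x m
      + ∑ m, arrowCount Q m k * x m := by
  induction l with
  | nil => simp at hk
  | cons i l ih =>
    rw [List.nodup_cons] at hn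
    rw [List.pairwise_cons] at hl
    have hcons : ∀ m, wordProd D (i :: l) x m = simpleReflection D i (wordProd D l x) m :=
      fun _ => rfl
    have hii : ¬ Q i i := fun h => by have := hQ.1 _ _ h; rw [D.diag] at this; omega
    have hsum : ∀ a, ¬ Q a i → ∑ m, arrowCount Q a m * wordProd D (i :: l) x m
        = ∑ m, arrowCount Q a m * wordProd D l x m := by
      intro a ha
      refine Finset.sum_congr rfl fun m _ => ?_
      by_cases hm : m = i
      · subst hm; simp [arrowCount, ha]
      · rw [hcons, simpleReflection_apply_of_ne D hm]
    by_cases hki : k = i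
    · subst hki
      have h2 : ∑ m, arrowCount Q m k * wordProd D l x m = ∑ m, arrowCount Q m k * x m := by
        refine Finset.sum_congr rfl fun m _ => ?_
        by_cases hm : m ∈ l
        · simp [arrowCount, hl.1 m hm]
        · rw [wordProd_apply_of_notMem D hm]
      rw [hsum k hii, hcons, simpleReflection_apply_self hQ, h2, wordProd_apply_of_notMem D hn.1]
      ring
    · have hkl : k ∈ l := (List.mem_cons.mp hk).resolve_left hki
      rw [hsum k (hl.1 k hkl), hcons, simpleReflection_apply_of_ne D hki, ih hn.2 hl.2 hkl]

/-- For y = α_k this is `wordProd_apply_add` with the terms regrouped. -/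
theorem eulerBilin_coxeter (hQ : IsOrientation D Q) {c : List I} (hc : IsCoxeterWord Q c)
    (x y : I → ℤ) : eulerBilin Q y (wordProd D c x) = -eulerBilin Q x y := by
  have h : ∀ k, eulerBilin Q (simpleRoot k) (wordProd D c x)
      = -eulerBilin Q x (simpleRoot k) := by
    intro k
    have := wordProd_apply_add hQ hc.1 (IsAdapted.pairwise hc.1 hc.2.2) x (hc.2.1 k)
    rw [eulerBilin_simpleRoot_left, eulerBilin_simpleRoot_right]
    linarith
  rw [eq_sum_simpleRoot y]
  simp only [map_sum, map_smul, LinearMap.sum_apply, LinearMap.smul_apply, smul_eq_mul, h, mul_neg,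
    Finset.sum_neg_distrib]

theorem form_wordProd (D : SimplyLacedCartan I) (l : List I) (x : I → ℤ) :
    wordProd D l x ⬝ᵥ D.C.mulVec (wordProd D l x) = x ⬝ᵥ D.C.mulVec x := by
  refine form_weyl D (list_prod_mem ?_) x
  intro s hs
  obtain ⟨i, _, rfl⟩ := List.mem_map.mp hs
  exact Subgroup.subset_closure ⟨i, rfl⟩

end Coxeter

/-! ## Coefficients of the inverse quantum Cartan matrix -/

section QuantumCartan

variable {I : Type*} [Fintype I] [DecidableEq I] {D : SimplyLacedCartan I} {Q : I → I → Prop}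

/-- This is the coefficient of z^m in the (i, j) entry of C(z)⁻¹ C(z) = 1. -/
theorem quantumCartan_inv_recursion (hQ : IsOrientation D Q) (i j : I) (m : ℤ) :
    ((quantumCartan D)⁻¹ i j).coeff (m - 1) + ((quantumCartan D)⁻¹ i j).coeff (m + 1)
      = ∑ k, (arrowCount Q j k + arrowCount Q k j) * ((quantumCartan D)⁻¹ i k).coeff m
        + if i = j ∧ m = 0 then 1 else 0 := by
  have h := congrFun (congrFun
    (Matrix.nonsing_inv_mul (quantumCartan D) (isUnit_det_quantumCartan D)) i) j
  rw [Matrix.mul_apply] at h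
  set N := (quantumCartan D)⁻¹
  have hterm : ∀ k, (N i k * quantumCartan D k j).coeff m
      = (if k = j then (N i j).coeff (m - 1) + (N i j).coeff (m + 1) else 0)
        - (arrowCount Q j k + arrowCount Q k j) * (N i k).coeff m := by
    intro k
    have hC := cartan_eq hQ k j
    by_cases hkj : k = j
    · subst hkj
      rw [D.diag, if_pos rfl] at hC
      have h0 : arrowCount Q k k + arrowCount Q k k = 0 := by omega
      simp [quantumCartan, mul_add, HahnSeries.coeff_mul_single, h0]
    · rw [if_neg hkj] at hC
      have h0 : arrowCount Q j k + arrowCount Q k j = - D.C k j := by omega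
      rw [h0]
      rcases D.simplyLaced hkj with h1 | h1 <;> simp [quantumCartan, hkj, h1]
  have h2 := congrArg (fun f : LaurentSeries ℤ => f.coeff m) h
  simp only [HahnSeries.coeff_sum, hterm, Finset.sum_sub_distrib, Finset.sum_ite_eq',
    Finset.mem_univ, if_true, Matrix.one_apply] at h2
  have h3 : (if i = j then (1 : LaurentSeries ℤ) else 0).coeff m
      = if i = j ∧ m = 0 then 1 else 0 := by
    by_cases hij : i = j <;> simp [hij, HahnSeries.coeff_one]
  rw [h3] at h2
  linarith

/-- The row has orders bounded below, and the recursion has no inhomogeneous term in degrees below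
0, so the vanishing propagates upwards. Hence the truncation in `cTilde` discards nothing and the
recursion holds for all m. -/
theorem quantumCartan_inv_coeff_nonpos (hQ : IsOrientation D Q) (i j : I) {m : ℤ} (hm : m ≤ 0) :
    ((quantumCartan D)⁻¹ i j).coeff m = 0 := by
  obtain ⟨b, hb⟩ : ∃ b : ℤ, ∀ j, b ≤ ((quantumCartan D)⁻¹ i j).order := by
    obtain ⟨b, hb⟩ := (Set.finite_range fun j => ((quantumCartan D)⁻¹ i j).order).bddBelow
    exact ⟨b, fun j => hb ⟨j, rfl⟩⟩
  have key : ∀ n : ℕ, ∀ j, ∀ m : ℤ, m < b + n → m ≤ 0 →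
      ((quantumCartan D)⁻¹ i j).coeff m = 0 := by
    intro n
    induction n with
    | zero =>
      intro j m h _
      refine HahnSeries.coeff_eq_zero_of_lt_order (lt_of_lt_of_le ?_ (hb j))
      simpa using h
    | succ n ih =>
      intro j m h h0
      push_cast at h
      have hr := quantumCartan_inv_recursion hQ i j (m - 1)
      rw [sub_add_cancel, ih j (m - 1 - 1) (by omega) (by omega), Finset.sum_eq_zero,
        if_neg (by omega)] at hr
      · simpa using hr
      · intro k _
        rw [ih k (m - 1) (by omega) (by omega), mul_zero]
  exact key (m - b + 1).toNat j m (by omega) hm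

theorem cTilde_eq_coeff (hQ : IsOrientation D Q) (i j : I) (m : ℤ) :
    cTilde D i j m = ((quantumCartan D)⁻¹ i j).coeff m := by
  unfold cTilde
  split_ifs with h
  · rfl
  · rw [quantumCartan_inv_coeff_nonpos hQ i j (by omega)]

theorem cTilde_of_nonpos (D : SimplyLacedCartan I) (i j : I) {m : ℤ} (hm : m ≤ 0) :
    cTilde D i j m = 0 := if_neg (by omega)

theorem cTilde_recursion (hQ : IsOrientation D Q) (i j : I) (m : ℤ) :
    cTilde D i j (m - 1) + cTilde D i j (m + 1)
      = ∑ k, (arrowCount Q j k + arrowCount Q k j) * cTilde D i k m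
        + if i = j ∧ m = 0 then 1 else 0 := by
  simp only [cTilde_eq_coeff hQ]
  exact quantumCartan_inv_recursion hQ i j m

theorem cTilde_one (hQ : IsOrientation D Q) (i j : I) :
    cTilde D i j 1 = if i = j then 1 else 0 := by
  have h := cTilde_recursion hQ i j 0
  simpa [cTilde_of_nonpos] using h

/-- The recursion starts at j = i, m = 1 and moves to a neighbour for each unit of m, while ξ
changes by one along an edge. This removes the boundary term of the telescoping sum. -/
theorem cTilde_eq_zero_of_height (hQ : IsOrientation D Q) {ξ : I → ℤ}
    (hξ : IsHeightFunction Q ξ) (i j : I) {m : ℤ} (hm : m < ξ j - ξ i) : cTilde D i j m = 0 := by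
  have key : ∀ n : ℕ, ∀ j, ∀ m : ℤ, m ≤ n → m < ξ j - ξ i → cTilde D i j m = 0 := by
    intro n
    induction n with
    | zero => intro j m h _; exact cTilde_of_nonpos D i j (by simpa using h)
    | succ n ih =>
      intro j m h h'
      push_cast at h
      by_cases h0 : m ≤ 0
      · exact cTilde_of_nonpos D i j h0
      have hr := cTilde_recursion hQ i j (m - 1)
      rw [sub_add_cancel, ih j (m - 1 - 1) (by omega) (by omega), Finset.sum_eq_zero,
        if_neg] at hr
      · simpa using hr
      · rintro ⟨rfl, h1⟩; omega
      · intro k _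
        by_cases h1 : Q j k
        · rw [ih k _ (by omega) (by have := hξ _ _ h1; omega), mul_zero]
        by_cases h2 : Q k j
        · rw [ih k _ (by omega) (by have := hξ _ _ h2; omega), mul_zero]
        simp [arrowCount, h1, h2]
  exact key m.toNat j m (by omega) hm

end QuantumCartan

/-! ## The signed roots `τ^r γ_j` -/

section Slices

variable {I : Type*}

/-- `τ^r γ_j`, which is `β_{φ(j, ξ(j) - 2r)}` up to sign. -/
def orbitRoot (Q : I → I → Prop) (τ : (I → ℤ) ≃ₗ[ℤ] (I → ℤ)) (j : I) (r : ℕ) : I → ℤ :=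
  τ^[r] (gammaRoot Q j)

theorem orbitRoot_succ (Q : I → I → Prop) (τ : (I → ℤ) ≃ₗ[ℤ] (I → ℤ)) (j : I) (r : ℕ) :
    orbitRoot Q τ j (r + 1) = τ (orbitRoot Q τ j r) :=
  Function.iterate_succ_apply' _ _ _

/-- A slice of the repetition quiver, consisting of the vertices `(j, ξ(j) - 2 d(j))`: neighbours
have heights that differ by one. -/
def IsSlice (Q : I → I → Prop) (d : I → ℕ) : Prop :=
  ∀ i j, Q i j → d j = d i ∨ d i = d j + 1

/-- The orientation of the Dynkin diagram defined by a slice, from larger to smaller heights. -/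
def sliceQuiver (Q : I → I → Prop) (d : I → ℕ) (i j : I) : Prop :=
  (Q i j ∧ d i = d j) ∨ (Q j i ∧ d j = d i + 1)

/-- A source of the slice lies one above all its neighbours; this and the next lemma say so in terms
of d for the two directions of arrows in Q. -/
theorem IsSlice.eq_of_source {Q : I → I → Prop} {d : I → ℕ} (hd : IsSlice Q d) {j k : I}
    (hj : IsSource (sliceQuiver Q d) j) (h : Q j k) : d k = d j :=
  (hd j k h).resolve_right fun h' => hj k (Or.inr ⟨h, h'⟩)

theorem IsSlice.eq_succ_of_source {Q : I → I → Prop} {d : I → ℕ} (hd : IsSlice Q d) {j k : I}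
    (hj : IsSource (sliceQuiver Q d) j) (h : Q k j) : d k = d j + 1 :=
  (hd k j h).resolve_left fun h' => hj k (Or.inl ⟨h, h'.symm⟩)

theorem eulerBilin_orbitRoot_succ [Fintype I] {Q : I → I → Prop}
    {τ : (I → ℤ) ≃ₗ[ℤ] (I → ℤ)} (hτ : ∀ x y, eulerBilin Q y (τ x) = -eulerBilin Q x y)
    (j : I) (r : ℕ) (y : I → ℤ) :
    eulerBilin Q y (orbitRoot Q τ j (r + 1)) = -eulerBilin Q (orbitRoot Q τ j r) y := by
  rw [orbitRoot_succ, hτ]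

/-- The coordinates of `x` with respect to the basis of simple roots attached to a slice. -/
def sliceCoord [Fintype I] (Q : I → I → Prop) (τ : (I → ℤ) ≃ₗ[ℤ] (I → ℤ)) (d : I → ℕ)
    (x : I → ℤ) : I → ℤ :=
  fun i => eulerBilin Q x (orbitRoot Q τ i (d i))

theorem sliceCoord_sub [Fintype I] {Q : I → I → Prop} {τ : (I → ℤ) ≃ₗ[ℤ] (I → ℤ)} (d : I → ℕ)
    (x y : I → ℤ) :
    sliceCoord Q τ d (x - y) = sliceCoord Q τ d x - sliceCoord Q τ d y := by
  ext i; simp [sliceCoord]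

theorem sliceCoord_neg [Fintype I] {Q : I → I → Prop} {τ : (I → ℤ) ≃ₗ[ℤ] (I → ℤ)} (d : I → ℕ)
    (x : I → ℤ) :
    sliceCoord Q τ d (-x) = -sliceCoord Q τ d x := by
  ext i; simp [sliceCoord]

variable [DecidableEq I]

/-- Every slice is obtained from the slice `d = 0` by flips at sources. -/
theorem slice_induction [Fintype I] {Q : I → I → Prop} {ξ : I → ℤ} (hξ : IsHeightFunction Q ξ)
    {P : (I → ℕ) → Prop} (h0 : P 0)
    (hstep : ∀ d j, IsSlice Q d → IsSource (sliceQuiver Q d) j → P d →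
      P (Function.update d j (d j + 1)))
    {d : I → ℕ} (hd : IsSlice Q d) : P d := by
  have hirr : ∀ i, ¬ Q i i := fun i h => by have := hξ _ _ h; omega
  induction hn : ∑ i, d i using Nat.strong_induction_on generalizing d with
  | _ n ih =>
    by_cases hz : d = 0
    · rwa [hz]
    have hne : (Finset.univ.filter fun i => 0 < d i).Nonempty := by
      obtain ⟨i, hi⟩ := Function.ne_iff.mp hz
      exact ⟨i, by simpa [Nat.pos_iff_ne_zero] using hi⟩
    -- A vertex of least height among those already moved can be moved back: no neighbour lies below
    -- it, so the result is a slice with j as a source.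
    obtain ⟨j, hj, hmin⟩ := Finset.exists_min_image _ (fun i => ξ i - 2 * (d i : ℤ)) hne
    simp only [Finset.mem_filter, Finset.mem_univ, true_and] at hj hmin
    have hout : ∀ k, Q j k → d j = d k + 1 := fun k hk => (hd j k hk).resolve_left fun h => by
      have := hmin k (by omega); have := hξ _ _ hk; omega
    have hin : ∀ k, Q k j → d j = d k := fun k hk => (hd k j hk).resolve_right fun h => by
      have := hmin k (by omega); have := hξ _ _ hk; omega
    set d' := Function.update d j (d j - 1) with hd'
    have hdj : d' j = d j - 1 := by simp [hd']
    have hdk : ∀ k, k ≠ j → d' k = d k := fun k hk => by simp [hd', hk]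
    have hback : Function.update d' j (d' j + 1) = d := by
      ext k
      by_cases hk : k = j
      · subst hk; rw [Function.update_self, hdj]; omega
      · rw [Function.update_of_ne hk, hdk k hk]
    have hsl : IsSlice Q d' := by
      intro a b hab
      by_cases ha : a = j
      · subst ha
        have hb : b ≠ a := fun h => hirr a (h ▸ hab)
        have := hout b hab
        rw [hdj, hdk b hb]; omega
      · by_cases hb : b = j
        · subst hb
          have := hin a hab
          rw [hdj, hdk a ha]; omega
        · rw [hdk a ha, hdk b hb]; exact hd a b hab
    have hsrc : IsSource (sliceQuiver Q d') j := by
      rintro k (⟨h1, h2⟩ | ⟨h1, h2⟩)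
      · have hk : k ≠ j := fun h => hirr j (h ▸ h1)
        have := hin k h1
        rw [hdj, hdk k hk] at h2; omega
      · have hk : k ≠ j := fun h => hirr j (h ▸ h1)
        have := hout k h1
        rw [hdj, hdk k hk] at h2; omega
    have hsum : ∑ i, d' i < n := by
      rw [← hn]
      refine Finset.sum_lt_sum (fun i _ => ?_) ⟨j, Finset.mem_univ j, by omega⟩
      by_cases hi : i = j
      · subst hi; omega
      · rw [hdk i hi]
    rw [← hback]
    exact hstep d' j hsl hsrc (ih _ hsum hsl rfl)

/-- The slice of the vertices of maximal heights at most `p`. -/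
def truncSlice {I : Type*} (ξ : I → ℤ) (p : ℤ) (j : I) : ℕ := ((ξ j - p + 1) / 2).toNat

theorem isSlice_truncSlice {I : Type*} {Q : I → I → Prop} {ξ : I → ℤ}
    (hξ : IsHeightFunction Q ξ) (p : ℤ) : IsSlice Q (truncSlice ξ p) := by
  intro i j h
  have := hξ i j h
  unfold truncSlice
  omega

theorem lt_truncSlice {I : Type*} (ξ : I → ℤ) (p : ℤ) (j : I) (r : ℕ) :
    r < truncSlice ξ p j ↔ p < ξ j - 2 * (r : ℤ) := by
  unfold truncSlice
  omega

theorem isSource_truncSlice {I : Type*} {Q : I → I → Prop} {ξ : I → ℤ}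
    (hξ : IsHeightFunction Q ξ) {p : ℤ} {i : I} {a : ℕ} (hi : ξ i - 2 * (a : ℤ) = p) :
    IsSource (sliceQuiver Q (truncSlice ξ p)) i := by
  rintro k (⟨h1, h2⟩ | ⟨h1, h2⟩)
  · have := hξ _ _ h1
    unfold truncSlice at h2
    omega
  · have := hξ _ _ h1
    unfold truncSlice at h2
    omega

variable [Fintype I] {D : SimplyLacedCartan I} {Q : I → I → Prop} {ξ : I → ℤ}
  {τ : (I → ℤ) ≃ₗ[ℤ] (I → ℤ)}

theorem gammaRoot_eq_add (hQ : IsOrientation D Q) (hξ : IsHeightFunction Q ξ) (j : I) :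
    gammaRoot Q j = simpleRoot j + ∑ k, arrowCount Q k j • gammaRoot Q k := by
  refine eulerBilin_right_ext hQ fun x => ?_
  simp only [map_add, map_sum, map_smul, smul_eq_mul, eulerBilin_gammaRoot hQ hξ,
    eulerBilin_simpleRoot_right]
  ring

/-- The mesh relations. -/
theorem orbitRoot_mesh (hQ : IsOrientation D Q) (hξ : IsHeightFunction Q ξ)
    (hτ : ∀ x y, eulerBilin Q y (τ x) = -eulerBilin Q x y) (j : I) (r : ℕ) :
    orbitRoot Q τ j r + orbitRoot Q τ j (r + 1)
      = ∑ k, arrowCount Q j k • orbitRoot Q τ k r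
        + ∑ k, arrowCount Q k j • orbitRoot Q τ k (r + 1) := by
  induction r with
  | zero =>
    -- Paired with x, the terms τγ_k become -⟨γ_k, x⟩ and the γ_k become coordinates of x. What
    -- remains is `gammaRoot_eq_add` paired with x on the other side.
    refine eulerBilin_right_ext hQ fun x => ?_
    have h := congrArg (fun y => eulerBilin Q y x) (gammaRoot_eq_add hQ hξ j)
    simp only [map_add, map_sum, map_smul, LinearMap.add_apply, LinearMap.sum_apply,
      LinearMap.smul_apply, smul_eq_mul, eulerBilin_simpleRoot_left] at h
    simp only [map_add, map_sum, map_smul, smul_eq_mul, eulerBilin_orbitRoot_succ hτ]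
    simp only [orbitRoot, Function.iterate_zero, id, eulerBilin_gammaRoot hQ hξ, h, mul_neg,
      Finset.sum_neg_distrib]
    ring
  | succ r ih =>
    have h := congrArg τ ih
    simpa only [map_add, map_sum, map_smul, ← orbitRoot_succ] using h

theorem sliceCoord_zero (hQ : IsOrientation D Q) (hξ : IsHeightFunction Q ξ) (x : I → ℤ) :
    sliceCoord Q τ 0 x = x := by
  ext i
  simp [sliceCoord, orbitRoot, eulerBilin_gammaRoot hQ hξ]

/-- The mesh relation at a source of a slice. -/
theorem orbitRoot_source (hQ : IsOrientation D Q) (hξ : IsHeightFunction Q ξ)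
    (hτ : ∀ x y, eulerBilin Q y (τ x) = -eulerBilin Q x y) {d : I → ℕ} (hd : IsSlice Q d) {j : I}
    (hj : IsSource (sliceQuiver Q d) j) :
    orbitRoot Q τ j (d j + 1)
      = ∑ k, (arrowCount Q j k + arrowCount Q k j) • orbitRoot Q τ k (d k)
        - orbitRoot Q τ j (d j) := by
  have h1 : ∀ k, arrowCount Q j k • orbitRoot Q τ k (d j)
      = arrowCount Q j k • orbitRoot Q τ k (d k) := by
    intro k
    by_cases h : Q j k
    · rw [hd.eq_of_source hj h]
    · simp [arrowCount, h]
  have h2 : ∀ k, arrowCount Q k j • orbitRoot Q τ k (d j + 1)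
      = arrowCount Q k j • orbitRoot Q τ k (d k) := by
    intro k
    by_cases h : Q k j
    · rw [hd.eq_succ_of_source hj h]
    · simp [arrowCount, h]
  have h := orbitRoot_mesh hQ hξ hτ j (d j)
  simp only [h1, h2] at h
  simp only [add_smul, Finset.sum_add_distrib, ← h]
  abel

/-- Only the coordinate at j changes, and the mesh relation at a source is the formula for s_j. -/
theorem sliceCoord_update (hQ : IsOrientation D Q) (hξ : IsHeightFunction Q ξ)
    (hτ : ∀ x y, eulerBilin Q y (τ x) = -eulerBilin Q x y) {d : I → ℕ} (hd : IsSlice Q d) {j : I}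
    (hj : IsSource (sliceQuiver Q d) j) (x : I → ℤ) :
    sliceCoord Q τ (Function.update d j (d j + 1)) x
      = simpleReflection D j (sliceCoord Q τ d x) := by
  ext i
  by_cases hi : i = j
  · subst hi
    rw [simpleReflection_apply_self hQ, sliceCoord, Function.update_self,
      orbitRoot_source hQ hξ hτ hd hj]
    simp only [map_sub, map_sum, map_smul, smul_eq_mul, add_mul, Finset.sum_add_distrib,
      sliceCoord]
  · rw [simpleReflection_apply_of_ne D hi, sliceCoord, sliceCoord, Function.update_of_ne hi]

/-- Slice coordinates arise from the standard ones by simple reflections, hence isometrically. So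
roots have coherent signs with respect to every slice. -/
theorem form_sliceCoord (hQ : IsOrientation D Q) (hξ : IsHeightFunction Q ξ)
    (hτ : ∀ x y, eulerBilin Q y (τ x) = -eulerBilin Q x y) {d : I → ℕ} (hd : IsSlice Q d)
    (x : I → ℤ) :
    sliceCoord Q τ d x ⬝ᵥ D.C.mulVec (sliceCoord Q τ d x) = x ⬝ᵥ D.C.mulVec x := by
  refine slice_induction hξ (P := fun d =>
    sliceCoord Q τ d x ⬝ᵥ D.C.mulVec (sliceCoord Q τ d x) = x ⬝ᵥ D.C.mulVec x) ?_ ?_ hd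
  · rw [sliceCoord_zero hQ hξ]
  · intro d j hd hj ih
    rw [sliceCoord_update hQ hξ hτ hd hj, form_reflection, ih]

theorem sliceCoord_injective (hQ : IsOrientation D Q) (hξ : IsHeightFunction Q ξ)
    (hτ : ∀ x y, eulerBilin Q y (τ x) = -eulerBilin Q x y) {d : I → ℕ} (hd : IsSlice Q d)
    {x y : I → ℤ} (h : sliceCoord Q τ d x = sliceCoord Q τ d y) : x = y := by
  by_contra hne
  have h1 := form_pos D (sub_ne_zero.mpr hne)
  rw [← form_sliceCoord hQ hξ hτ hd, sliceCoord_sub, h, sub_self] at h1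
  simp at h1

/-- In the coordinates of a slice, its vectors v(j, d j) satisfy the recursion of the roots γ_j for
the orientation given by the slice; in particular a source has coordinates α_j. The recursion is
carried through each flip. -/
theorem sliceCoord_orbitRoot (hQ : IsOrientation D Q) (hξ : IsHeightFunction Q ξ)
    (hτ : ∀ x y, eulerBilin Q y (τ x) = -eulerBilin Q x y) {d : I → ℕ} (hd : IsSlice Q d)
    (j : I) :
    sliceCoord Q τ d (orbitRoot Q τ j (d j)) = simpleRoot j
      + ∑ k, arrowCount (sliceQuiver Q d) k j • sliceCoord Q τ d (orbitRoot Q τ k (d k)) := by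
  have hirr : ∀ i, ¬ Q i i := fun i h => by have := hξ _ _ h; omega
  refine slice_induction hξ (P := fun d => ∀ j,
    sliceCoord Q τ d (orbitRoot Q τ j (d j)) = simpleRoot j
      + ∑ k, arrowCount (sliceQuiver Q d) k j • sliceCoord Q τ d (orbitRoot Q τ k (d k)))
    ?_ ?_ hd j
  · intro j
    have h : sliceQuiver Q 0 = Q := by
      ext a b
      simp [sliceQuiver]
    simp only [sliceCoord_zero hQ hξ, h]
    exact gammaRoot_eq_add hQ hξ j
  · intro d j hd hj ih a
    set d' := Function.update d j (d j + 1) with hd'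
    have hdj : d' j = d j + 1 := by simp [hd']
    have hdk : ∀ k, k ≠ j → d' k = d k := fun k hk => by simp [hd', hk]
    have hup : ∀ x, sliceCoord Q τ d' x = simpleReflection D j (sliceCoord Q τ d x) :=
      sliceCoord_update hQ hξ hτ hd hj
    have hsrc : sliceCoord Q τ d (orbitRoot Q τ j (d j)) = simpleRoot j := by
      rw [ih j, Finset.sum_eq_zero, add_zero]
      intro k _
      simp [arrowCount, hj k]
    have hneg : simpleReflection D j (simpleRoot j : I → ℤ) = -simpleRoot j :=
      Module.reflection_apply_self (coroot_simpleRoot D j)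
    have hw : ∀ k, arrowCount (sliceQuiver Q d') k j = arrowCount Q j k + arrowCount Q k j := by
      intro k
      by_cases hk : k = j
      · subst hk
        simp [arrowCount, sliceQuiver, hirr]
      have h3 : ¬ (Q j k ∧ Q k j) := fun ⟨h, h'⟩ => by
        have := hξ _ _ h; have := hξ _ _ h'; omega
      by_cases h1 : Q j k
      · have h2 : ¬ Q k j := fun h => h3 ⟨h1, h⟩
        have := hd.eq_of_source hj h1
        simp [arrowCount, sliceQuiver, h1, h2, hdj, hdk k hk, this]
      · by_cases h2 : Q k j
        · have := hd.eq_succ_of_source hj h2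
          simp [arrowCount, sliceQuiver, h1, h2, hdj, hdk k hk, this]
        · simp [arrowCount, sliceQuiver, h1, h2]
    by_cases ha : a = j
    · subst ha
      have hterm : ∀ k, arrowCount (sliceQuiver Q d') k a • sliceCoord Q τ d'
          (orbitRoot Q τ k (d' k)) = (arrowCount Q a k + arrowCount Q k a) •
            sliceCoord Q τ d' (orbitRoot Q τ k (d k)) := by
        intro k
        rw [hw]
        by_cases hk : k = a
        · subst hk; simp [arrowCount, hirr]
        · rw [hdk k hk]
      -- At the flipped vertex, now a sink, the mesh relation subtracts the old vector, whose new
      -- coordinates are s_j α_j = -α_j; this supplies the term + α_j.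
      have hlin : sliceCoord Q τ d' (orbitRoot Q τ a (d a + 1))
          = ∑ k, (arrowCount Q a k + arrowCount Q k a) •
              sliceCoord Q τ d' (orbitRoot Q τ k (d k))
            - sliceCoord Q τ d' (orbitRoot Q τ a (d a)) := by
        rw [orbitRoot_source hQ hξ hτ hd hj]
        ext i
        simp only [sliceCoord, map_sub, map_sum, map_smul, LinearMap.sub_apply,
          LinearMap.sum_apply, LinearMap.smul_apply, Pi.sub_apply, Finset.sum_apply,
          Pi.smul_apply]
      simp only [hterm]
      rw [hdj, hlin, hup (orbitRoot Q τ a (d a)), hsrc, hneg]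
      abel
    -- Away from the flipped vertex, the α_j gained by s_j α_a makes up for the lost arrow j → a,
    -- whose term had become -α_j.
    · have hC : simpleReflection D j (simpleRoot a : I → ℤ)
          = simpleRoot a + arrowCount (sliceQuiver Q d) j a • (simpleRoot j : I → ℤ) := by
        have h1 : arrowCount (sliceQuiver Q d) j a = -D.C j a := by
          have h3 : ¬ (Q j a ∧ Q a j) := fun ⟨h, h'⟩ => by
            have := hξ _ _ h; have := hξ _ _ h'; omega
          rw [cartan_eq hQ, if_neg (Ne.symm ha)]
          by_cases h1 : Q j a
          · have h2 : ¬ Q a j := fun h => h3 ⟨h1, h⟩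
            have := hd.eq_of_source hj h1
            simp [arrowCount, sliceQuiver, h1, h2, this]
          · by_cases h2 : Q a j
            · have := hd.eq_succ_of_source hj h2
              simp [arrowCount, sliceQuiver, h1, h2, this]
            · simp [arrowCount, sliceQuiver, h1, h2]
        rw [simpleReflection_apply, h1]
        simp [simpleRoot, sub_eq_add_neg]
      have hsplit : ∑ k, arrowCount (sliceQuiver Q d') k a •
            sliceCoord Q τ d' (orbitRoot Q τ k (d' k))
          = ∑ k, arrowCount (sliceQuiver Q d) k a •
              simpleReflection D j (sliceCoord Q τ d (orbitRoot Q τ k (d k)))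
            + arrowCount (sliceQuiver Q d) j a • (simpleRoot j : I → ℤ) := by
        rw [← Finset.add_sum_erase _ _ (Finset.mem_univ j),
          ← Finset.add_sum_erase Finset.univ (fun k => arrowCount (sliceQuiver Q d) k a •
              simpleReflection D j (sliceCoord Q τ d (orbitRoot Q τ k (d k))))
            (Finset.mem_univ j), hsrc, hneg]
        have h0 : arrowCount (sliceQuiver Q d') j a = 0 := by
          have : ¬ sliceQuiver Q d' j a := by
            rintro (⟨h1, h2⟩ | ⟨h1, h2⟩)
            · have := hd.eq_of_source hj h1
              rw [hdj, hdk a ha] at h2; omega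
            · have := hd.eq_succ_of_source hj h1
              rw [hdj, hdk a ha] at h2; omega
          simp [arrowCount, this]
        have h1 : ∀ k ∈ Finset.univ.erase j, arrowCount (sliceQuiver Q d') k a •
              sliceCoord Q τ d' (orbitRoot Q τ k (d' k))
            = arrowCount (sliceQuiver Q d) k a •
              simpleReflection D j (sliceCoord Q τ d (orbitRoot Q τ k (d k))) := by
          intro k hk
          have hk := Finset.ne_of_mem_erase hk
          have h : sliceQuiver Q d' k a ↔ sliceQuiver Q d k a := by
            simp only [sliceQuiver, hdk k hk, hdk a ha]
          have h' : arrowCount (sliceQuiver Q d') k a = arrowCount (sliceQuiver Q d) k a := by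
            by_cases hs : sliceQuiver Q d k a
            · simp [arrowCount, hs, h.mpr hs]
            · simp [arrowCount, hs, mt h.mp hs]
          rw [hup, hdk k hk, h']
        rw [Finset.sum_congr rfl h1, h0, zero_smul, smul_neg]
        abel
      rw [hsplit, hdk a ha, hup, ih a, map_add, hC, map_sum]
      simp only [map_smul]
      abel

theorem sliceCoord_orbitRoot_source (hQ : IsOrientation D Q) (hξ : IsHeightFunction Q ξ)
    (hτ : ∀ x y, eulerBilin Q y (τ x) = -eulerBilin Q x y) {d : I → ℕ} (hd : IsSlice Q d)
    {j : I} (hj : IsSource (sliceQuiver Q d) j) :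
    sliceCoord Q τ d (orbitRoot Q τ j (d j)) = simpleRoot j := by
  rw [sliceCoord_orbitRoot hQ hξ hτ hd, Finset.sum_eq_zero, add_zero]
  intro k _
  simp [arrowCount, hj k]

/-- The sign with which `β` occurs in `x = ± β`, and `0` if `x ≠ ± β`. -/
def occurrenceSign (x β : I → ℤ) : ℤ := if x = β then 1 else if x = -β then -1 else 0

open Classical in
/-- The occurrences of a positive root `β` up to sign above a slice have alternating signs, so
that their signed number is `0` or `1`, according to the sign of `β` with respect to the slice. -/
theorem sum_occurrenceSign (hQ : IsOrientation D Q) (hξ : IsHeightFunction Q ξ)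
    (hτ : ∀ x y, eulerBilin Q y (τ x) = -eulerBilin Q x y) {d : I → ℕ} (hd : IsSlice Q d)
    {β : I → ℤ} (hβ : β ⬝ᵥ D.C.mulVec β = 2) (hβ0 : 0 ≤ β) :
    ∑ j, ∑ r ∈ Finset.range (d j), occurrenceSign (orbitRoot Q τ j r) β
      = if 0 ≤ sliceCoord Q τ d β then 0 else 1 := by
  refine slice_induction hξ (P := fun d =>
    ∑ j, ∑ r ∈ Finset.range (d j), occurrenceSign (orbitRoot Q τ j r) β
      = if 0 ≤ sliceCoord Q τ d β then 0 else 1) ?_ ?_ hd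
  · simp [sliceCoord_zero hQ hξ, hβ0]
  · intro d j hd hj ih
    have hsum : ∑ i, ∑ r ∈ Finset.range (Function.update d j (d j + 1) i),
          occurrenceSign (orbitRoot Q τ i r) β
        = ∑ i, ∑ r ∈ Finset.range (d i), occurrenceSign (orbitRoot Q τ i r) β
          + occurrenceSign (orbitRoot Q τ j (d j)) β := by
      rw [← Finset.add_sum_erase _ _ (Finset.mem_univ j),
        ← Finset.add_sum_erase Finset.univ (fun i => ∑ r ∈ Finset.range (d i),
          occurrenceSign (orbitRoot Q τ i r) β) (Finset.mem_univ j), Function.update_self,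
        Finset.sum_range_succ]
      have h : ∀ i ∈ Finset.univ.erase j, ∑ r ∈ Finset.range (Function.update d j (d j + 1) i),
            occurrenceSign (orbitRoot Q τ i r) β
          = ∑ r ∈ Finset.range (d i), occurrenceSign (orbitRoot Q τ i r) β := fun i hi => by
        rw [Function.update_of_ne (Finset.ne_of_mem_erase hi)]
      rw [Finset.sum_congr rfl h]
      ring
    rw [hsum, ih, sliceCoord_update hQ hξ hτ hd hj]
    have hsrc := sliceCoord_orbitRoot_source hQ hξ hτ hd hj
    have hform : sliceCoord Q τ d β ⬝ᵥ D.C.mulVec (sliceCoord Q τ d β) = 2 := by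
      rw [form_sliceCoord hQ hξ hτ hd, hβ]
    have hneg : simpleReflection D j (simpleRoot j : I → ℤ) = -simpleRoot j :=
      Module.reflection_apply_self (coroot_simpleRoot D j)
    have hpos : (0 : I → ℤ) ≤ simpleRoot j := by
      intro k
      simp only [simpleRoot, Pi.single_apply, Pi.zero_apply]
      split_ifs <;> simp
    have hnpos : ¬ (0 : I → ℤ) ≤ -simpleRoot j := fun h => by
      have := h j
      simp [simpleRoot] at this
    -- Passing β itself turns its coordinates from α_j to -α_j, and the count from 0 to 1; passing
    -- -β does the reverse; any other vector leaves the sign of β unchanged.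
    by_cases h1 : orbitRoot Q τ j (d j) = β
    · have hx : sliceCoord Q τ d β = simpleRoot j := by rw [← h1, hsrc]
      rw [hx, hneg, if_pos hpos, if_neg hnpos, occurrenceSign, if_pos h1, zero_add]
    by_cases h2 : orbitRoot Q τ j (d j) = -β
    · have hx : sliceCoord Q τ d β = -simpleRoot j := by
        rw [← hsrc, h2, sliceCoord_neg, neg_neg]
      rw [hx, map_neg, hneg, neg_neg, if_pos hpos, if_neg hnpos, occurrenceSign, if_neg h1,
        if_pos h2]
      norm_num
    · have hx1 : sliceCoord Q τ d β ≠ simpleRoot j := fun h =>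
        h1 (sliceCoord_injective hQ hξ hτ hd (by rw [hsrc, h]))
      have hx2 : -sliceCoord Q τ d β ≠ simpleRoot j := fun h =>
        h2 (sliceCoord_injective hQ hξ hτ hd (by rw [hsrc, sliceCoord_neg, h]))
      rw [occurrenceSign, if_neg h1, if_neg h2, add_zero]
      rcases nonneg_or_nonpos_of_form_eq_two D hform with h | h
      · rw [if_pos h, if_pos (simpleReflection_nonneg D hform h hx1)]
      · have hr := simpleReflection_nonneg D (by rw [form_neg, hform]) (neg_nonneg.mpr h) hx2
        rw [map_neg, neg_nonneg] at hr
        have hne : ∀ x : I → ℤ, x ⬝ᵥ D.C.mulVec x = 2 → x ≤ 0 → ¬ 0 ≤ x := by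
          intro x hx hx0 hx0'
          have : x = 0 := le_antisymm hx0 hx0'
          simp [this] at hx
        rw [if_neg (hne _ hform h), if_neg (hne _ (by rw [form_reflection, hform]) hr)]

/-- Coefficients of the inverse quantum Cartan matrix are values of the Euler form. -/
theorem cTilde_eq_eulerBilin (hQ : IsOrientation D Q) (hξ : IsHeightFunction Q ξ)
    (hτ : ∀ x y, eulerBilin Q y (τ x) = -eulerBilin Q x y) (i : I) (a : ℕ) (m : ℕ) (j : I)
    (r : ℕ) (h : ξ j - 2 * (r : ℤ) = ξ i - 2 * (a : ℤ) + m - 1) :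
    cTilde D i j m = eulerBilin Q (orbitRoot Q τ i a) (orbitRoot Q τ j r) := by
  set d := truncSlice ξ (ξ i - 2 * (a : ℤ)) with hd
  have hi : d i = a := by simp only [hd, truncSlice]; omega
  -- The vertex (i, a) is a source of the slice at its own height, so these pairings are δ_{ij}.
  -- They give the initial values m = 0 and m = 1.
  have hslice : ∀ j, eulerBilin Q (orbitRoot Q τ i a) (orbitRoot Q τ j (d j))
      = (simpleRoot i : I → ℤ) j := by
    intro j
    rw [← sliceCoord_orbitRoot_source hQ hξ hτ (isSlice_truncSlice hξ _)
      (isSource_truncSlice hξ rfl), ← hd, hi]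
    rfl
  induction m using Nat.strong_induction_on generalizing j r with
  | _ m ih =>
    match m, ih, h with
    | 0, _, h =>
      have hj : d j = r := by simp only [hd, truncSlice]; omega
      have hij : j ≠ i := by rintro rfl; omega
      rw [← hj, hslice, cTilde_of_nonpos D i j (by simp)]
      simp [simpleRoot, hij]
    | 1, _, h =>
      have hj : d j = r := by simp only [hd, truncSlice]; omega
      rw [← hj, hslice, Nat.cast_one, cTilde_one hQ]
      simp [simpleRoot, Pi.single_apply, eq_comm]
    | m + 2, ih, h =>
      push_cast at h
      have h0 := ih m (by omega) j (r + 1) (by push_cast; omega)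
      have h1 : ∀ k, arrowCount Q j k * cTilde D i k ((m + 1 : ℕ) : ℤ)
          = arrowCount Q j k * eulerBilin Q (orbitRoot Q τ i a) (orbitRoot Q τ k r) := by
        intro k
        by_cases hk : Q j k
        · rw [ih (m + 1) (by omega) k r (by have := hξ _ _ hk; push_cast; omega)]
        · simp [arrowCount, hk]
      have h2 : ∀ k, arrowCount Q k j * cTilde D i k ((m + 1 : ℕ) : ℤ)
          = arrowCount Q k j * eulerBilin Q (orbitRoot Q τ i a) (orbitRoot Q τ k (r + 1)) := by
        intro k
        by_cases hk : Q k j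
        · rw [ih (m + 1) (by omega) k (r + 1) (by have := hξ _ _ hk; push_cast; omega)]
        · simp [arrowCount, hk]
      -- The recursion and the mesh relation paired with v(i, a) agree term by term; the
      -- inhomogeneous term is absent since m + 1 ≠ 0.
      have hrec := cTilde_recursion hQ i j ((m + 1 : ℕ) : ℤ)
      have hmesh := congrArg (eulerBilin Q (orbitRoot Q τ i a)) (orbitRoot_mesh hQ hξ hτ j r)
      simp only [map_add, map_sum, map_smul, smul_eq_mul] at hmesh
      simp only [add_mul, Finset.sum_add_distrib, h1, h2] at hrec
      rw [if_neg (by push_cast; omega), ← hmesh] at hrec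
      have e1 : ((m + 1 : ℕ) : ℤ) - 1 = m := by push_cast; ring
      have e2 : ((m + 1 : ℕ) : ℤ) + 1 = ((m + 2 : ℕ) : ℤ) := by push_cast; ring
      rw [e1, e2, h0] at hrec
      linarith

end Slices

/-! ## The values of `D̃_ξ` on initial cluster variables -/

section Values

variable {I : Type*}

theorem prod_zpow_eq_zpow_sum {G ι : Type*} [CommGroup G] (g : G) (s : Finset ι) (f : ι → ℤ) :
    ∏ i ∈ s, g ^ f i = g ^ ∑ i ∈ s, f i := by
  classical
  induction s using Finset.induction_on with
  | empty => simp
  | insert a s ha ih => rw [Finset.prod_insert ha, Finset.sum_insert ha, ih, zpow_add]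

/-- The parametrisation of `I^{≤ξ}` by vertices and depths. -/
def indexEquiv (ξ : I → ℤ) : (Σ _ : I, ℕ) ≃ IndexSet ξ where
  toFun x := IndexSet.mk ξ x.1 x.2
  invFun q := ⟨q.vertex, q.depth⟩
  left_inv x := Sigma.ext rfl (heq_of_eq (IndexSet.depth_mk ξ x.1 x.2))
  right_inv q := q.mk_depth

/-- The vertices `(j, s)` of `I^{≤ξ}` with `s ≥ p`, by their depths. -/
def aboveHeight [Fintype I] (ξ : I → ℤ) (p : ℤ) : Finset (Σ _ : I, ℕ) :=
  Finset.univ.sigma fun j => Finset.range (truncSlice ξ (p - 1) j)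

theorem mem_aboveHeight [Fintype I] {ξ : I → ℤ} {p : ℤ} {x : Σ _ : I, ℕ} :
    x ∈ aboveHeight ξ p ↔ p ≤ ξ x.1 - 2 * (x.2 : ℤ) := by
  simp only [aboveHeight, Finset.mem_sigma, Finset.mem_univ, true_and, Finset.mem_range,
    lt_truncSlice]
  omega

variable [Fintype I] [DecidableEq I] {D : SimplyLacedCartan I} {Q : I → I → Prop} {ξ : I → ℤ}

theorem betaSeq_eq_or_neg (D : SimplyLacedCartan I) (Q : I → I → Prop)
    (τ : (I → ℤ) ≃ₗ[ℤ] (I → ℤ)) (j : I) (r : ℕ) :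
    betaSeq D Q τ j r = orbitRoot Q τ j r ∨ betaSeq D Q τ j r = -orbitRoot Q τ j r := by
  induction r with
  | zero => exact Or.inl rfl
  | succ r ih =>
    rw [betaSeq, orbitRoot_succ]
    rcases ih with h | h <;> rw [h] <;> split_ifs <;> simp

theorem betaSeq_mem_posRoots (hQ : IsOrientation D Q) (hξ : IsHeightFunction Q ξ) {c : List I}
    (j : I) (r : ℕ) : betaSeq D Q (wordProd D c) j r ∈ posRoots D := by
  induction r with
  | zero =>
    refine (mem_posRoots_iff D).mpr ⟨?_, gammaRoot_nonneg j⟩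
    rw [betaSeq, dotProduct_mulVec_cartan hQ, eulerBilin_gammaRoot hQ hξ, gammaRoot_self]
    norm_num
  | succ r ih =>
    rw [betaSeq]
    split_ifs with h
    · exact h
    have hf : wordProd D c (betaSeq D Q (wordProd D c) j r) ⬝ᵥ
        D.C.mulVec (wordProd D c (betaSeq D Q (wordProd D c) j r)) = 2 := by
      rw [form_wordProd, ((mem_posRoots_iff D).mp ih).1]
    rcases nonneg_or_nonpos_of_form_eq_two D hf with h0 | h0
    · exact absurd ((mem_posRoots_iff D).mpr ⟨hf, h0⟩) h
    · exact (mem_posRoots_iff D).mpr ⟨by rw [form_neg, hf], neg_nonneg.mpr h0⟩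

/-- The index set depends on a and not on l, and the second exponent is the first one at l + 1, so
that the product over l ≤ a telescopes. -/
theorem dTildeY_mk_eq_prod (D : SimplyLacedCartan I) (Q : I → I → Prop)
    (τ : (I → ℤ) ≃ₗ[ℤ] (I → ℤ)) (i : I) {a l : ℕ} (hl : l ≤ a) :
    dTildeY D Q τ (IndexSet.mk ξ i l)
      = ∏ x ∈ aboveHeight ξ (ξ i - 2 * (a : ℤ)), betaUnit D Q τ (IndexSet.mk ξ x.1 x.2) ^
        (cTilde D i x.1 (ξ x.1 - 2 * (x.2 : ℤ) - ξ i + 2 * (l : ℤ) - 1)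
          - cTilde D i x.1 (ξ x.1 - 2 * (x.2 : ℤ) - ξ i + 2 * ((l + 1 : ℕ) : ℤ) - 1)) := by
  have h1 : ∀ x : Σ _ : I, ℕ, ξ x.1 - 2 * (x.2 : ℤ) - ξ i + 2 * (l : ℤ) - 1
      = (IndexSet.mk ξ x.1 x.2).pos - (IndexSet.mk ξ i l).pos - 1 := by
    intro x; simp only [IndexSet.mk, IndexSet.pos]; ring
  have h2 : ∀ x : Σ _ : I, ℕ, ξ x.1 - 2 * (x.2 : ℤ) - ξ i + 2 * ((l + 1 : ℕ) : ℤ) - 1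
      = (IndexSet.mk ξ x.1 x.2).pos - (IndexSet.mk ξ i l).pos + 1 := by
    intro x; simp only [IndexSet.mk, IndexSet.pos]; push_cast; ring
  rw [dTildeY, ← finprod_comp_equiv (indexEquiv ξ)]
  simp only [h1, h2]
  refine finprod_eq_prod_of_mulSupport_subset _ fun x hx => ?_
  by_contra hx'
  rw [SetLike.mem_coe, mem_aboveHeight, not_le] at hx'
  refine hx ?_
  change betaUnit D Q τ (IndexSet.mk ξ x.1 x.2) ^ (cTilde D i x.1 _ - cTilde D i x.1 _) = 1
  have hpos : (IndexSet.mk ξ x.1 x.2).pos - (IndexSet.mk ξ i l).pos < 0 := by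
    simp only [IndexSet.mk, IndexSet.pos]; omega
  rw [cTilde_of_nonpos D i x.1, cTilde_of_nonpos D i x.1, sub_zero, zpow_zero]
  · change (IndexSet.mk ξ x.1 x.2).pos - (IndexSet.mk ξ i l).pos + 1 ≤ 0
    omega
  · change (IndexSet.mk ξ x.1 x.2).pos - (IndexSet.mk ξ i l).pos - 1 ≤ 0
    omega

theorem dTilde_monomialKR_eq_prod (hQ : IsOrientation D Q) (hξ : IsHeightFunction Q ξ)
    (τ : (I → ℤ) ≃ₗ[ℤ] (I → ℤ)) (i : I) (a : ℕ) :
    dTilde D Q τ ξ (monomialKR (IndexSet.mk ξ i a))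
      = ∏ x ∈ aboveHeight ξ (ξ i - 2 * (a : ℤ)), toField (betaSeq D Q τ x.1 x.2) ^
        (-cTilde D i x.1 (ξ x.1 - 2 * (x.2 : ℤ) - (ξ i - 2 * (a : ℤ)) + 1)) := by
  have h1 : dTilde D Q τ ξ (monomialKR (IndexSet.mk ξ i a))
      = ((∏ l ∈ Finset.range (a + 1), dTildeY D Q τ (IndexSet.mk ξ i l) : (RootField I)ˣ) :
          RootField I) := by
    rw [monomialKR, map_prod, IndexSet.depth_mk, Units.coe_prod]
    exact Finset.prod_congr rfl fun l _ => dTilde_Y D Q τ _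
  have h2 : ∏ l ∈ Finset.range (a + 1), dTildeY D Q τ (IndexSet.mk ξ i l)
      = ∏ x ∈ aboveHeight ξ (ξ i - 2 * (a : ℤ)), betaUnit D Q τ (IndexSet.mk ξ x.1 x.2) ^
        (-cTilde D i x.1 (ξ x.1 - 2 * (x.2 : ℤ) - (ξ i - 2 * (a : ℤ)) + 1)) := by
    rw [Finset.prod_congr rfl fun l hl =>
      dTildeY_mk_eq_prod D Q τ i (Nat.lt_succ_iff.mp (Finset.mem_range.mp hl)), Finset.prod_comm]
    refine Finset.prod_congr rfl fun x _ => ?_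
    -- The term at l = 0 has argument at most ξ(j) - ξ(i) - 1 and vanishes; the term at l = a + 1
    -- survives with a minus sign.
    rw [prod_zpow_eq_zpow_sum, Finset.sum_range_sub' fun l : ℕ =>
      cTilde D i x.1 (ξ x.1 - 2 * (x.2 : ℤ) - ξ i + 2 * (l : ℤ) - 1),
      cTilde_eq_zero_of_height hQ hξ i x.1 (by push_cast; omega), zero_sub]
    congr 3
    push_cast
    ring
  rw [h1, h2, Units.coe_prod]
  refine Finset.prod_congr rfl fun x _ => ?_
  rw [Units.val_zpow_eq_zpow_val, betaUnit, Units.val_mk0, beta, IndexSet.depth_mk]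
  rfl

/-- The exponent of a positive root in `D̃_ξ` of an initial cluster variable. -/
theorem sum_cTilde_eq (hQ : IsOrientation D Q) (hξ : IsHeightFunction Q ξ) {c : List I}
    (hc : IsCoxeterWord Q c) (i : I) (a : ℕ) {β : I → ℤ} (hβ : β ∈ posRoots D) :
    (∑ x ∈ aboveHeight ξ (ξ i - 2 * (a : ℤ)), if betaSeq D Q (wordProd D c) x.1 x.2 = β then
        cTilde D i x.1 (ξ x.1 - 2 * (x.2 : ℤ) - (ξ i - 2 * (a : ℤ)) + 1) else 0) = 0 ∨
    (∑ x ∈ aboveHeight ξ (ξ i - 2 * (a : ℤ)), if betaSeq D Q (wordProd D c) x.1 x.2 = β then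
        cTilde D i x.1 (ξ x.1 - 2 * (x.2 : ℤ) - (ξ i - 2 * (a : ℤ)) + 1) else 0)
      = |eulerForm Q (betaSeq D Q (wordProd D c) i a) β| := by
  set τ := wordProd D c with hτdef
  have hτ : ∀ x y, eulerBilin Q y (τ x) = -eulerBilin Q x y := eulerBilin_coxeter hQ hc
  obtain ⟨hβ2, hβ0⟩ := (mem_posRoots_iff D).mp hβ
  have hne : ∀ y ∈ posRoots D, y ≠ -β := by
    intro y hy h
    obtain ⟨_, hy0⟩ := (mem_posRoots_iff D).mp hy
    rw [h] at hy0
    have : β = 0 := le_antisymm (neg_nonneg.mp hy0) hβ0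
    simp [this] at hβ2
  -- If v(j, r) = εβ with ε = ± 1, bilinearity takes ε out of the coefficient, leaving a factor
  -- independent of (j, r).
  have hterm : ∀ x ∈ aboveHeight ξ (ξ i - 2 * (a : ℤ)),
      (if betaSeq D Q τ x.1 x.2 = β then
        cTilde D i x.1 (ξ x.1 - 2 * (x.2 : ℤ) - (ξ i - 2 * (a : ℤ)) + 1) else 0)
      = occurrenceSign (orbitRoot Q τ x.1 x.2) β * eulerBilin Q (orbitRoot Q τ i a) β := by
    intro x hx
    rw [mem_aboveHeight] at hx
    obtain ⟨m, hm⟩ := Int.eq_ofNat_of_zero_le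
      (show 0 ≤ ξ x.1 - 2 * (x.2 : ℤ) - (ξ i - 2 * (a : ℤ)) + 1 by omega)
    rw [hm, cTilde_eq_eulerBilin hQ hξ hτ i a m x.1 x.2 (by omega)]
    have hpos : betaSeq D Q τ x.1 x.2 ∈ posRoots D := betaSeq_mem_posRoots hQ hξ x.1 x.2
    have hββ := hne β hβ
    unfold occurrenceSign
    rcases betaSeq_eq_or_neg D Q τ x.1 x.2 with h | h
    · by_cases h1 : orbitRoot Q τ x.1 x.2 = β
      · rw [h, if_pos h1, if_pos h1, h1, one_mul]
      · have h2 : orbitRoot Q τ x.1 x.2 ≠ -β := h ▸ hne _ hpos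
        rw [h, if_neg h1, if_neg h1, if_neg h2, zero_mul]
    · by_cases h1 : betaSeq D Q τ x.1 x.2 = β
      · have h2 : orbitRoot Q τ x.1 x.2 = -β := by rw [← h1, h, neg_neg]
        rw [if_pos h1, if_neg (by rw [h2]; exact hββ.symm), if_pos h2, h2, map_neg, neg_one_mul]
      · have h2 : orbitRoot Q τ x.1 x.2 ≠ -β := fun h' => h1 (by rw [h, h', neg_neg])
        have h3 : orbitRoot Q τ x.1 x.2 ≠ β := fun h' => hne _ hpos (by rw [h, h'])
        rw [if_neg h1, if_neg h3, if_neg h2, zero_mul]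
  have habs : |eulerForm Q (betaSeq D Q τ i a) β| = |eulerBilin Q (orbitRoot Q τ i a) β| := by
    rw [← eulerBilin_apply]
    rcases betaSeq_eq_or_neg D Q τ i a with h | h <;> simp [h]
  -- The slice at height p - 1 has exactly the vertices of height at least p above it, including (i,
  -- p); hence its depth at i is a + 1.
  have hd := isSlice_truncSlice hξ (ξ i - 2 * (a : ℤ) - 1)
  rw [Finset.sum_congr rfl hterm, ← Finset.sum_mul, aboveHeight, Finset.sum_sigma,
    sum_occurrenceSign hQ hξ hτ hd hβ2 hβ0, habs]
  split_ifs with h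
  · exact Or.inl (zero_mul _)
  · right
    have hform : sliceCoord Q τ _ β ⬝ᵥ D.C.mulVec (sliceCoord Q τ _ β) = 2 :=
      (form_sliceCoord hQ hξ hτ hd β).trans hβ2
    have hi := ((nonneg_or_nonpos_of_form_eq_two D hform).resolve_left h) i
    have hdi : truncSlice ξ (ξ i - 2 * (a : ℤ) - 1) i = a + 1 := by
      simp only [truncSlice]; omega
    rw [sliceCoord, hdi, eulerBilin_orbitRoot_succ hτ, Pi.zero_apply] at hi
    rw [one_mul, abs_of_nonneg (neg_nonpos.mp hi)]

theorem dTilde_monomialKR (hQ : IsOrientation D Q) (hξ : IsHeightFunction Q ξ) {c : List I}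
    (hc : IsCoxeterWord Q c) (q : IndexSet ξ) :
    ∃ n : posRoots D → ℕ,
      dTilde D Q (wordProd D c) ξ (monomialKR q)
          = ∏ β : posRoots D, 1 / toField (β : I → ℤ) ^ n β ∧
      ∀ β : posRoots D, n β ≠ 0 →
        (n β : ℤ) = |eulerForm Q (beta D Q (wordProd D c) q) (β : I → ℤ)| := by
  set i := q.vertex with hi
  set a := q.depth with ha
  have hq : IndexSet.mk ξ i a = q := q.mk_depth
  let e : (I → ℤ) → ℤ := fun β => ∑ x ∈ aboveHeight ξ (ξ i - 2 * (a : ℤ)),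
    if betaSeq D Q (wordProd D c) x.1 x.2 = β then
      cTilde D i x.1 (ξ x.1 - 2 * (x.2 : ℤ) - (ξ i - 2 * (a : ℤ)) + 1) else 0
  have he : ∀ β : posRoots D, e β = 0 ∨
      -- Either alternative makes the integer exponent nonnegative, so `Int.toNat` loses nothing.
      e β = |eulerForm Q (beta D Q (wordProd D c) q) (β : I → ℤ)| := fun β =>
    sum_cTilde_eq hQ hξ hc i a β.2
  have hn : ∀ β : posRoots D, ((e β).toNat : ℤ) = e β := fun β =>
    Int.toNat_of_nonneg (by rcases he β with h | h <;> rw [h]; exact abs_nonneg _)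
  refine ⟨fun β => (e β).toNat, ?_, fun β hβ => ?_⟩
  · have hβ : ∀ β : posRoots D, 1 / toField (β : I → ℤ) ^ (e β).toNat
        = ∏ x ∈ aboveHeight ξ (ξ i - 2 * (a : ℤ)),
          if betaSeq D Q (wordProd D c) x.1 x.2 = β then toField (β : I → ℤ) ^
            (-cTilde D i x.1 (ξ x.1 - 2 * (x.2 : ℤ) - (ξ i - 2 * (a : ℤ)) + 1)) else 1 := by
      intro β
      have hβ0 : (β : I → ℤ) ≠ 0 := fun h => by
        have := ((mem_posRoots_iff D).mp β.2).1
        simp [h] at this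
      have hu := prod_zpow_eq_zpow_sum (Units.mk0 _ (toField_ne_zero hβ0))
        (aboveHeight ξ (ξ i - 2 * (a : ℤ)))
        (fun x => -if betaSeq D Q (wordProd D c) x.1 x.2 = β then
          cTilde D i x.1 (ξ x.1 - 2 * (x.2 : ℤ) - (ξ i - 2 * (a : ℤ)) + 1) else 0)
      have hu' := congrArg (Units.val) hu
      rw [Finset.sum_neg_distrib, Units.coe_prod, Units.val_zpow_eq_zpow_val, Units.val_mk0] at hu'
      rw [one_div, ← zpow_natCast, hn, ← zpow_neg, ← hu']
      refine Finset.prod_congr rfl fun x _ => ?_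
      rw [Units.val_zpow_eq_zpow_val, Units.val_mk0]
      split_ifs <;> simp
    rw [Finset.prod_congr rfl fun β _ => hβ β, Finset.prod_comm, ← hq,
      dTilde_monomialKR_eq_prod hQ hξ]
    refine Finset.prod_congr rfl fun x _ => ?_
    -- After exchanging the products, each (j, r) contributes to exactly one positive root, its own.
    rw [Finset.prod_eq_single ⟨_, betaSeq_mem_posRoots hQ hξ x.1 x.2⟩, if_pos rfl]
    · intro β _ hne
      exact if_neg fun h => hne (Subtype.ext h.symm)
    · simp
  · rw [hn]
    refine (he β).resolve_left fun h => hβ ?_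
    change (e β).toNat = 0
    rw [h, Int.toNat_zero]

end Values

end HL

end

theorem proposition6p4 {I : Type*} [Fintype I] [DecidableEq I] [Nonempty I]
    (D : HL.SimplyLacedCartan I)
    (Q : I → I → Prop) (hQ : HL.IsOrientation D Q)
    (ξ : I → ℤ) (hξ : HL.IsHeightFunction Q ξ)
    (c : List I) (hc : HL.IsCoxeterWord Q c)
    (w : List I) (hw : HL.IsAdaptedLongestWord D Q w)
    (t : ℕ) (ht : 1 ≤ t) :
    ∃ y : HL.Torus ξ,
      algebraMap (HL.Torus ξ) (FractionRing (HL.Torus ξ)) y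
          = HL.iota D ξ (HL.clusterVar D ξ w t) ∧
      ∃ n : HL.posRoots D → ℕ,
        HL.dTilde D Q (HL.wordProd D c) ξ y
            = ∏ β : HL.posRoots D, 1 / HL.toField (β : I → ℤ) ^ n β ∧
        ∀ β : HL.posRoots D, n β ≠ 0 →
          (n β : ℤ)
            = |HL.eulerForm Q (HL.beta D Q (HL.wordProd D c) (HL.phiInv D ξ w t)) (β : I → ℤ)| :=
  -- `HL.iota` takes values in a fraction field; on an initial variable the value is a monomial of
  -- the torus, which serves as the witness.
  ⟨HL.monomialKR (HL.phiInv D ξ w t), (HL.iota_initialVar D ξ _).symm,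
    HL.dTilde_monomialKR hQ hξ hc _⟩
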